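/- Let $d\ge 1$ and $\mathbb S=[0,1]^d$ with the Euclidean metric. Let $\mathcal H$ be a reproducing kernel Hilbert space of functions $h:\mathbb X\to\mathbb R$ on a measurable space $\mathbb X$, with Bochner-measurable feature map $\phi(x)=k(x,\cdot)$. Let $(X,S),(X_1,S_1),(X_2,S_2),\dots$ be i.i.d. random variables with values in $\mathbb X\times\mathbb S$ on a probability space $(\Omega,\mathcal A,P)$, let $\phi(X)$ be Bochner-integrable, let $E^S\phi(X)$ be the conditional expectation of $\phi(X)$ given $\sigma(S)$, and let $\mathcal F_n=\sigma(X_1,S_1,\dots,X_n,S_n)$. For $\ell\ge 1$ let $\mathfrak D_\ell$ be the partition of $\mathbb S$ into $\ell^d$ cubes of side length $1/\ell$ with lower corners in $\ell^{-1}\mathbb Z^d$ (each cube containing its lower faces, and an upper face only if it lies on the upper boundary of $\mathbb S$). For $\Delta\subseteq\mathbb S$ let $P_n(S\in\Delta)=\frac1n\sum_{i\le n}\chi\{S_i\in\Delta\}$, and let $$E_n(\phi(X)\mid S\in\Delta)=\frac{1}{n\,P_n(S\in\Delta)}\sum_{i\le n}\phi(X_i)\,\chi\{S_i\in\Delta\}$$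 if $P_n(S\in\Delta)>0$, and $E_n(\phi(X)\mid S\in\Delta)=0$ otherwise. With integers $\ell_n$ such that $\ell_n\asymp n^{1/(2(d+1))}$ as $n\to\infty$ (for example $\ell_n=\lfloor n^{1/(2(d+1))}\rfloor$) put $$E_n^S\phi(X)=\sum_{\Delta\in\mathfrak D_{\ell_n}}E_n(\phi(X)\mid S\in\Delta)\,\chi\{S\in\Delta\}.$$ Suppose that 1. the law $PS^{-1}$ has a density $u$ with respect to Lebesgue measure on $\mathbb S$ with $\inf_{s\in\mathbb S}u(s)\ge b$ for some $b>0$; 2. there are $L\ge 0$ and an $L$-Lipschitz function $g:\mathbb S\to\mathcal H$ with $E^S\phi(X)=g\circ S$ almost surely; 3. the class of functions $(x,s)\mapsto h(x)\,\chi_\Delta(s)$ on $\mathbb X\times\mathbb S$, with $h\in\mathcal H$, $\|h\|\le 1$ and $\Delta\in\bigcup_{\ell\ge 1}\mathfrak D_\ell$, is a Donsker class for the law of $(X,S)$. Then $$\Bigl(E^{\mathcal F_n}\bigl\|E_n^S\phi(X)-E^S\phi(X)\bigr\|^2\Bigr)^{1/2}\in O^*_P\bigl(n^{-\frac1{2(d+1)}}\bigr),$$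 that is, for every $\varepsilon>0$ there is $M>0$ such that for all $n\ge 1$ the left-hand side exceeds $M\,n^{-1/(2(d+1))}$ with outer probability at most $\varepsilon$. -/

import Mathlib

open MeasureTheory ProbabilityTheory Filter Topology
open scoped ENNReal NNReal BoundedContinuousFunction

namespace ObliviousFeatures

noncomputable section

/-! ### Donsker classes -/

section Donsker

variable {E : Type*} [MeasurableSpace E]

/-- The Banach space `ℓ^∞(F)` of bounded real functions on `F`, with the supremum norm. -/
abbrev EllInfty (F : Set (E → ℝ)) : Type _ := lp (fun _ : F => ℝ) ∞

/-- `ℓ^∞(F)` carries its Borel sigma-algebra. -/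
instance instMeasurableSpaceEllInfty (F : Set (E → ℝ)) : MeasurableSpace (EllInfty F) :=
  borel (EllInfty F)

instance instBorelSpaceEllInfty (F : Set (E → ℝ)) : BorelSpace (EllInfty F) := ⟨rfl⟩

/-- Outer expectation `E^* T` of a bounded real function `T` that need not be measurable: the
infimum of the expectations of all integrable measurable majorants of `T`. -/
def outerExpectation {Ω : Type*} [MeasurableSpace Ω] (P : Measure Ω) (T : Ω → ℝ) : ℝ :=
  sInf {r : ℝ | ∃ U : Ω → ℝ, Measurable U ∧ Integrable U P ∧ (∀ ω, T ω ≤ U ω) ∧ ∫ ω, U ω ∂P = r}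

/-- The value `√n (ν_n f - ν f)` at `f` of the empirical process of the observations
`x 0, …, x (n-1)`. -/
def empiricalProcessFun (ν : Measure E) (n : ℕ) (x : Fin n → E) (f : E → ℝ) : ℝ :=
  √(n : ℝ) * ((n : ℝ)⁻¹ * ∑ i, f (x i) - ∫ y, f y ∂ν)

open Classical in
/-- The empirical process indexed by `F`, as an element of `ℓ^∞(F)`. (The default value `0` is
never used for the classes considered in `IsDonsker`, for which the process is bounded.) -/
def empiricalProcess (ν : Measure E) (F : Set (E → ℝ)) (n : ℕ) (x : Fin n → E) : EllInfty F :=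
  if h : Memℓp (fun f : F => empiricalProcessFun ν n x f) ∞ then
    ⟨fun f : F => empiricalProcessFun ν n x f, h⟩
  else 0

/-- `Γ` is the law on `ℓ^∞(F)` of a tight `ν`-Brownian bridge: a tight Borel probability measure
under which the coordinate process is a centred Gaussian process with covariance
`ν (f f') - ν f * ν f'`. -/
structure IsTightBrownianBridgeLaw (ν : Measure E) (F : Set (E → ℝ)) (Γ : Measure (EllInfty F)) :
    Prop where
  isProbabilityMeasure : IsProbabilityMeasure Γ
  isTight : IsTightMeasureSet {Γ}
  isGaussian : IsGaussianProcess (fun (f : F) (z : EllInfty F) => z f) Γ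
  mean_eq_zero : ∀ f : F, ∫ z : EllInfty F, z f ∂Γ = 0
  covariance_eq : ∀ f f' : F,
    covariance (fun z : EllInfty F => z f) (fun z : EllInfty F => z f') Γ =
      covariance (f : E → ℝ) (f' : E → ℝ) ν

/-- `F` is a `ν`-Donsker class, for a probability measure `ν`: `F ⊆ L²(ν)`, `sup_{f ∈ F} |f x - ν f| < ∞` for every `x`, and the
empirical processes `√n (ν_n - ν)` of i.i.d. observations with law `ν` converge in law in
`ℓ^∞(F)` (in the sense of Hoffmann-Jørgensen) to a tight `ν`-Brownian bridge. -/
structure IsDonsker (ν : Measure E) (F : Set (E → ℝ)) : Prop where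
  memLp : ∀ f ∈ F, MemLp f 2 ν
  bddAbove : ∀ x : E, BddAbove (Set.range fun f : F => |(f : E → ℝ) x - ∫ y, (f : E → ℝ) y ∂ν|)
  tendsto_law : ∃ Γ : Measure (EllInfty F), IsTightBrownianBridgeLaw ν F Γ ∧
    ∀ Φ : EllInfty F →ᵇ ℝ,
      Tendsto
        (fun n : ℕ => outerExpectation (Measure.pi fun _ : Fin n => ν)
          fun x => Φ (empiricalProcess ν F n x))
        atTop (𝓝 (∫ z, Φ z ∂Γ))

end Donsker

/-! ### Stochastic order in outer probability -/

/-- `Y n ∈ O*_P(r n)`: the sequence `Y n / r n`, `n ≥ 1`, is bounded in outer probability. On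
non-measurable sets `P` is the outer measure. -/
def IsBigOStarP {Ω : Type*} [MeasurableSpace Ω] (P : Measure Ω) (Y : ℕ → Ω → ℝ≥0∞) (r : ℕ → ℝ) :
    Prop :=
  ∀ ε : ℝ, 0 < ε → ∃ M : ℝ, 0 < M ∧
    ∀ n : ℕ, 1 ≤ n → P {ω | ENNReal.ofReal (M * r n) < Y n ω} ≤ ENNReal.ofReal ε

/-! ### The unit cube and its dyadic cubes -/

/-- The cube `[0,1]^d` with the Euclidean metric. -/
abbrev UnitCube (d : ℕ) : Type :=
  ({s | ∀ k, s k ∈ Set.Icc (0 : ℝ) 1} : Set (EuclideanSpace ℝ (Fin d)))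

/-- Lebesgue measure on `[0,1]^d`. -/
def cubeVolume (d : ℕ) : Measure (UnitCube d) :=
  Measure.comap Subtype.val (volume : Measure (EuclideanSpace ℝ (Fin d)))

/-- The cube of side length `1/ℓ` with lower corner `j/ℓ`, in the partition of `[0,1]^d` into
`ℓ^d` such cubes. It contains its lower faces, and an upper face only if that face lies on the
upper boundary of `[0,1]^d`. -/
def dyadicCube (d ℓ : ℕ) (j : Fin d → Fin ℓ) : Set (UnitCube d) :=
  {s | ∀ k, ((j k : ℕ) : ℝ) / ℓ ≤ s.1 k ∧
    (s.1 k < (((j k : ℕ) : ℝ) + 1) / ℓ ∨ ((j k : ℕ) + 1 = ℓ ∧ s.1 k = 1))}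

/-! ### The reproducing kernel Hilbert space -/

section RKHS

variable {𝕏 : Type*} (H : Type*) [NormedAddCommGroup H] [InnerProductSpace ℝ H] [RKHS ℝ H 𝕏 ℝ]

/-- The feature map `φ x = k(x, ·)`. -/
def featureMap [CompleteSpace H] (x : 𝕏) : H := RKHS.kerFun H x (1 : ℝ)

/-- The functions `(x, s) ↦ h x * χ_Δ s` on `𝕏 × [0,1]^d`, with `h` in the unit ball of `H` and
`Δ` a dyadic cube of side length `1/ℓ` for some `ℓ ≥ 1`. -/
def dyadicBallClass (d : ℕ) : Set (𝕏 × UnitCube d → ℝ) :=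
  {f | ∃ h : H, ‖h‖ ≤ 1 ∧ ∃ ℓ : ℕ, 1 ≤ ℓ ∧ ∃ j : Fin d → Fin ℓ,
    f = fun p => h p.1 * (dyadicCube d ℓ j).indicator (fun _ => (1 : ℝ)) p.2}

end RKHS

/-! ### The plug-in estimator -/

section PlugIn

variable {Ω 𝕏 𝕊 H : Type*} [NormedAddCommGroup H] [InnerProductSpace ℝ H]

/-- The empirical measure `P_n(S ∈ B) = (1/n) ∑_{i < n} δ_{S_i}(B)`. -/
def empiricalProb (Ss : ℕ → Ω → 𝕊) (n : ℕ) (B : Set 𝕊) (ω : Ω) : ℝ :=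
  (1 / (n : ℝ)) * ∑ i ∈ Finset.range n, B.indicator (fun _ => (1 : ℝ)) (Ss i ω)

open Classical in
/-- The estimate `E_n(φ(X) | S ∈ B)`, which is `0` if no observation falls into `B`. -/
def empiricalCondMean (φ : 𝕏 → H) (Xs : ℕ → Ω → 𝕏) (Ss : ℕ → Ω → 𝕊) (n : ℕ) (B : Set 𝕊)
    (ω : Ω) : H :=
  if 0 < empiricalProb Ss n B ω then
    (1 / (n * empiricalProb Ss n B ω)) •
      ∑ i ∈ Finset.range n, B.indicator (fun _ => (1 : ℝ)) (Ss i ω) • φ (Xs i ω)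
  else 0

/-- The plug-in estimator `E_n^S φ(X) = ∑_Δ E_n(φ(X) | S ∈ Δ) χ{S ∈ Δ}`, where `Δ` runs over the
dyadic cubes of side length `1/ℓ`. -/
def plugInEstimator {d : ℕ} (φ : 𝕏 → H) (Xs : ℕ → Ω → 𝕏) (Ss : ℕ → Ω → UnitCube d)
    (S : Ω → UnitCube d) (n ℓ : ℕ) (ω : Ω) : H :=
  ∑ j : Fin d → Fin ℓ,
    (dyadicCube d ℓ j).indicator (fun _ => (1 : ℝ)) (S ω) •
      empiricalCondMean φ Xs Ss n (dyadicCube d ℓ j) ω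

/-- The sigma-algebra `ℱ_n` generated by the sample `(X_i, S_i)`, `i < n`. -/
abbrev sampleSigma [MeasurableSpace 𝕏] [MeasurableSpace 𝕊] (Xs : ℕ → Ω → 𝕏) (Ss : ℕ → Ω → 𝕊)
    (n : ℕ) : MeasurableSpace Ω :=
  ⨆ i : Fin n, MeasurableSpace.comap (fun ω => (Xs i ω, Ss i ω)) inferInstance

/-- The conditional `L²` pseudo-norm `(E^m ‖Z‖²)^{1/2}` given a sigma-algebra `m`, as a random
variable with values in `[0, ∞]`. -/
def condL2Norm [MeasurableSpace Ω] (P : Measure Ω) (m : MeasurableSpace Ω) (Z : Ω → H) (ω : Ω) :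
    ℝ≥0∞ :=
  (condLExp m P (fun ω' => ‖Z ω'‖ₑ ^ 2) ω) ^ (1 / 2 : ℝ)

end PlugIn

end

end ObliviousFeatures

/-! The error splits over cubes into a bias and a fluctuation. On a cube the bias is at most `L * √d
/ ℓ`, because the cell mean of `φ(X)` is an average of `g` over that cube (`norm_cellMean_sub_le`).
The fluctuation is a sum of independent centred vectors divided by the number of observations in the
cube. On the event `manyInCubes` that number is at least `n p_j / 2`, where `p_j ≥ b / ℓ ^ d` is the
probability of the cube. Since `(X, S)` is independent of the sample, cube `j` then contributes to
the mean square error a term of order `σ_j² / (n p_j)`. The `σ_j²` sum to at most `E‖φ(X)‖²`, which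
gives order `ℓ ^ d / n` in total (`setLIntegral_enorm_plugIn_sub_sq_le`).

Let `q = n ^ (1 / (2 (d + 1)))`, so that `n = q ^ (2 d + 2)`. For `ℓ ≍ q` the squared bias is of
order `q⁻²`, the variance is no larger, and by Chebyshev and a union bound `manyInCubes` fails with
probability of order `ℓ ^ (2 d) / n ≍ q⁻²`. This event lies in `ℱ_n`, so Markov's inequality applies
to the conditional norm on it (`measure_lt_condL2Norm_le`).

All this needs `E‖φ(X)‖² < ∞`, which the Donsker property supplies (`IsDonsker.memLp_featureMap`).
The limiting Brownian bridge is almost surely linear along finite families in `H`, so by duality `∑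
k, z (e k) ^ 2 ≤ ‖z‖ ^ 2` for orthonormal `e`. Gaussian second moments are comparable to their
truncations to a set of large probability. Truncating to a fixed ball therefore bounds `∑ k, Var (e
k)` uniformly in `e`. -/

namespace ObliviousFeatures

/-! ### Second moments and Gaussian processes -/

/-- The fourth moment of the standard normal distribution. -/
noncomputable def stdNormalFourthMoment : ℝ := ∫ x, x ^ 4 ∂(gaussianReal 0 1)

lemma stdNormalFourthMoment_nonneg : 0 ≤ stdNormalFourthMoment :=
  integral_nonneg fun x => by positivity

section Gaussian

variable {E : Type*} [MeasurableSpace E] {Γ : Measure E}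

/-- A centred Gaussian variable is distributed as `√v` times a standard one, also for `v = 0`. -/
lemma integral_pow_four_of_hasGaussianLaw {X : E → ℝ} (hX : HasGaussianLaw X Γ)
    (h0 : ∫ x, X x ∂Γ = 0) :
    ∫ x, X x ^ 4 ∂Γ = stdNormalFourthMoment * (∫ x, X x ^ 2 ∂Γ) ^ 2 := by
  have := hX.isProbabilityMeasure
  have hm := hX.aemeasurable
  have hvar : Var[X; Γ] = ∫ x, X x ^ 2 ∂Γ := variance_of_integral_eq_zero hm h0
  have hlaw := hX.map_eq_gaussianReal
  rw [h0] at hlaw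
  set v := Var[X; Γ].toNNReal with hv
  have hvv : (v : ℝ) = ∫ x, X x ^ 2 ∂Γ := by
    rw [hv, Real.coe_toNNReal _ (variance_nonneg _ _), hvar]
  have hmap : gaussianReal 0 v = (gaussianReal 0 1).map (√(v : ℝ) * ·) := by
    rw [gaussianReal_map_const_mul]
    congr 1
    · simp
    · ext
      simp [Real.sq_sqrt]
  have h4 : ∫ x, X x ^ 4 ∂Γ = ∫ y, y ^ 4 ∂(Γ.map X) := by
    rw [integral_map hm (by fun_prop)]
  rw [h4, hlaw, hmap, integral_map (by fun_prop) (by fun_prop), stdNormalFourthMoment, ← hvv,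
    mul_comm, ← integral_const_mul]
  congr 1 with y
  rw [mul_pow, show √(v : ℝ) ^ 4 = (√(v : ℝ) ^ 2) ^ 2 by ring, Real.sq_sqrt v.coe_nonneg]

/-- The second moment of a centred Gaussian variable is uniformly concentrated on sets of large
probability. -/
lemma integral_sq_le_two_mul_setIntegral {X : E → ℝ} (hX : HasGaussianLaw X Γ)
    (h0 : ∫ x, X x ∂Γ = 0) {T : Set E} (hT : MeasurableSet T)
    (hTc : Γ.real Tᶜ ≤ 1 / (4 * (stdNormalFourthMoment + 1))) :
    ∫ x, X x ^ 2 ∂Γ ≤ 2 * ∫ x in T, X x ^ 2 ∂Γ := by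
  have := hX.isProbabilityMeasure
  set C := stdNormalFourthMoment with hC
  have hC0 : 0 ≤ C := stdNormalFourthMoment_nonneg
  have h4eq := integral_pow_four_of_hasGaussianLaw hX h0
  have hi2 : Integrable (fun x => X x ^ 2) Γ := (hX.memLp (p := 2) (by simp)).integrable_sq
  have hi4 : Integrable (fun x => X x ^ 4) Γ := by
    have := (hX.memLp (p := 4) (by simp)).integrable_norm_pow (p := 4) (by simp)
    refine this.congr (ae_of_all _ fun x => ?_)
    simp only [Real.norm_eq_abs]
    rw [show |X x| ^ 4 = (|X x| ^ 2) ^ 2 by ring, sq_abs]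
    ring
  set σ := ∫ x, X x ^ 2 ∂Γ with hσ
  have hσ0 : 0 ≤ σ := integral_nonneg fun x => by positivity
  have hsplit := integral_add_compl hT hi2
  rcases hσ0.eq_or_lt with h | hpos
  · rw [← h]
    have : 0 ≤ ∫ x in T, X x ^ 2 ∂Γ := integral_nonneg fun x => by positivity
    linarith
  -- On `Tᶜ` use `X² ≤ X⁴ / (2 K σ) + K σ / 2`. With this `K` each of the two terms integrates to at
  -- most `σ / 4`, so `Tᶜ` carries at most half of `σ`.
  set K := 2 * (C + 1) with hK
  have hK0 : 0 < K := by positivity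
  have key : ∫ x in Tᶜ, X x ^ 2 ∂Γ ≤
      ∫ x in Tᶜ, (1 / 2 * (X x ^ 4 / (K * σ)) + 1 / 2 * (K * σ)) ∂Γ := by
    refine integral_mono hi2.integrableOn ?_ fun x => ?_
    · exact (((hi4.div_const _).const_mul _).add (integrable_const _)).integrableOn
    · have : 0 ≤ (X x ^ 2 - K * σ) ^ 2 / (K * σ) := by positivity
      have h' : (X x ^ 2 - K * σ) ^ 2 / (K * σ) = X x ^ 4 / (K * σ) - 2 * X x ^ 2 + K * σ := by
        field_simp
        ring
      change X x ^ 2 ≤ 1 / 2 * (X x ^ 4 / (K * σ)) + 1 / 2 * (K * σ)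
      linarith
  have hle4 : ∫ x in Tᶜ, X x ^ 4 ∂Γ ≤ C * σ ^ 2 := by
    rw [← h4eq]
    exact setIntegral_le_integral hi4 (ae_of_all _ fun x => by positivity)
  rw [integral_add ((hi4.div_const _).const_mul _).integrableOn (integrable_const _),
    integral_const_mul, integral_div, setIntegral_const, smul_eq_mul] at key
  have e1 : (∫ x in Tᶜ, X x ^ 4 ∂Γ) / (K * σ) ≤ σ / 2 := by
    rw [div_le_iff₀ (by positivity)]
    refine hle4.trans ?_
    rw [hK]
    nlinarith [sq_nonneg σ]
  have e2 : Γ.real Tᶜ * (1 / 2 * (K * σ)) ≤ 1 / 2 * (σ / 2) := by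
    calc _ ≤ 1 / (4 * (C + 1)) * (1 / 2 * (K * σ)) := by gcongr
      _ = _ := by rw [hK]; field_simp; ring
  linarith

/-- If the coordinates of a Gaussian vector satisfy `∑ k, z k ^ 2 ≤ R ^ 2` almost surely, then the
sum of their second moments is controlled by the tail of `R` alone. -/
lemma sum_integral_sq_le_of_sum_sq_le {ι : Type*} [Fintype ι] [IsProbabilityMeasure Γ]
    {z : ι → E → ℝ} (hz : ∀ k, HasGaussianLaw (z k) Γ) (h0 : ∀ k, ∫ x, z k x ∂Γ = 0)
    {R : E → ℝ} (hR : ∀ᵐ x ∂Γ, ∑ k, z k x ^ 2 ≤ R x ^ 2) {T : Set E} (hT : MeasurableSet T)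
    (hTc : Γ.real Tᶜ ≤ 1 / (4 * (stdNormalFourthMoment + 1))) {t : ℝ}
    (ht : ∀ x ∈ T, R x ^ 2 ≤ t) :
    ∑ k, ∫ x, z k x ^ 2 ∂Γ ≤ 2 * t := by
  have hi2 : ∀ k, Integrable (fun x => z k x ^ 2) Γ := fun k =>
    ((hz k).memLp (p := 2) (by simp)).integrable_sq
  -- A point of `T` is needed to know `0 ≤ t`; an empty `T` contradicts the bound on `Tᶜ`.
  by_cases hne : T.Nonempty
  swap
  · exfalso
    rw [Set.not_nonempty_iff_eq_empty] at hne
    subst hne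
    have := stdNormalFourthMoment_nonneg
    simp only [Set.compl_empty, probReal_univ] at hTc
    rw [le_div_iff₀ (by positivity)] at hTc
    linarith
  have ht0 : 0 ≤ t := by
    obtain ⟨x, hx⟩ := hne
    exact (sq_nonneg _).trans (ht x hx)
  calc ∑ k, ∫ x, z k x ^ 2 ∂Γ ≤ ∑ k, 2 * ∫ x in T, z k x ^ 2 ∂Γ :=
        Finset.sum_le_sum fun k _ => integral_sq_le_two_mul_setIntegral (hz k) (h0 k) hT hTc
    _ = 2 * ∫ x in T, ∑ k, z k x ^ 2 ∂Γ := by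
        rw [← Finset.mul_sum, integral_finsetSum _ fun k _ => (hi2 k).integrableOn]
    _ ≤ 2 * ∫ x in T, t ∂Γ := by
        gcongr 2 * ?_
        refine setIntegral_mono_ae_restrict
          (integrable_finsetSum _ fun k _ => (hi2 k).integrableOn) (integrable_const _) ?_
        filter_upwards [ae_restrict_of_ae hR, ae_restrict_mem hT] with x hx hxT
        exact hx.trans (ht x hxT)
    _ ≤ 2 * t := by
        rw [setIntegral_const, smul_eq_mul]
        gcongr
        exact mul_le_of_le_one_left ht0 measureReal_le_one

/-- A family of centred square-integrable variables whose covariances agree with those of a family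
satisfying a linear relation satisfies that relation almost surely. -/
lemma ae_sum_mul_eq_zero_of_covariance_eq {E' ι : Type*} [Fintype ι] [MeasurableSpace E']
    {ν : Measure E'} [IsProbabilityMeasure Γ] [IsProbabilityMeasure ν]
    {z : ι → E → ℝ} {y : ι → E' → ℝ}
    (hz : ∀ i, MemLp (z i) 2 Γ) (hy : ∀ i, MemLp (y i) 2 ν) (h0 : ∀ i, ∫ x, z i x ∂Γ = 0)
    (hcov : ∀ i j, cov[z i, z j; Γ] = cov[y i, y j; ν]) {c : ι → ℝ}
    (hc : ∀ x, ∑ i, c i * y i x = 0) :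
    ∀ᵐ x ∂Γ, ∑ i, c i * z i x = 0 := by
  have hz' : ∀ i, MemLp (c i • z i) 2 Γ := fun i => (hz i).const_smul _
  have hy' : ∀ i, MemLp (c i • y i) 2 ν := fun i => (hy i).const_smul _
  have hzs : MemLp (∑ i, c i • z i) 2 Γ := memLp_finsetSum' _ fun i _ => hz' i
  have hysum : ∑ i, c i • y i = 0 := by
    ext x
    simpa using hc x
  -- The variance depends on the covariances alone, hence equals that of `∑ i, c i • y i = 0`.
  have hvar : Var[∑ i, c i • z i; Γ] = 0 := by
    rw [← covariance_self hzs.aemeasurable, covariance_sum_sum hz' hz']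
    have : cov[∑ i, c i • y i, ∑ i, c i • y i; ν] = 0 := by simp [hysum]
    rw [covariance_sum_sum hy' hy'] at this
    rw [← this]
    simp_rw [covariance_smul_left, covariance_smul_right, hcov]
  have hmean : ∫ x, (∑ i, c i • z i) x ∂Γ = 0 := by
    simp only [Finset.sum_apply, Pi.smul_apply, smul_eq_mul]
    rw [integral_finsetSum _ fun i _ => ((hz i).integrable (by simp)).const_mul _]
    simp [integral_const_mul, h0]
  rw [variance_of_integral_eq_zero hzs.aemeasurable hmean] at hvar
  have := (integral_eq_zero_iff_of_nonneg (fun x => sq_nonneg _) hzs.integrable_sq).1 hvar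
  filter_upwards [this] with x hx
  simpa using hx

/-- The square sum of a vector is at most `r ^ 2` if its pairings with a dense set of vectors are
bounded by `r` times the norm. -/
lemma sum_sq_le_of_denseRange {ι : Type*} [Fintype ι] {D : ℕ → EuclideanSpace ℝ ι}
    (hD : DenseRange D) (v : EuclideanSpace ℝ ι) {r : ℝ} (hr : 0 ≤ r)
    (h : ∀ n, |∑ k, D n k * v k| ≤ ‖D n‖ * r) : ∑ k, v k ^ 2 ≤ r ^ 2 := by
  have h' : ∀ a : EuclideanSpace ℝ ι, |∑ k, a k * v k| ≤ ‖a‖ * r := fun a =>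
    hD.induction_on (p := fun a => |∑ k, a k * v k| ≤ ‖a‖ * r) a
      (isClosed_le (by fun_prop) (by fun_prop)) h
  have hv := h' v
  have hn : ∑ k, v k * v k = ‖v‖ ^ 2 := by
    rw [EuclideanSpace.norm_sq_eq]
    simp [sq]
  rw [hn, abs_of_nonneg (sq_nonneg _)] at hv
  have : ‖v‖ ≤ r := by
    by_contra! hlt
    nlinarith [norm_nonneg v]
  calc ∑ k, v k ^ 2 = ‖v‖ ^ 2 := by rw [← hn]; simp [sq]
    _ ≤ r ^ 2 := by gcongr

end Gaussian

/-! ### The Donsker property forces a square-integrable feature map -/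

section HilbertBasis

universe u

variable {H : Type u} [NormedAddCommGroup H] [InnerProductSpace ℝ H]

/-- Distinct orthonormal vectors are `√2` apart, so balls of radius `1 / 2` around them are
disjoint. -/
lemma _root_.Orthonormal.countable_of_separableSpace [TopologicalSpace.SeparableSpace H]
    {ι : Type*} {e : ι → H} (he : Orthonormal ℝ e) : Countable ι := by
  have hd : Pairwise (Function.onFun Disjoint fun i => Metric.ball (e i) (1 / 2)) := by
    intro i j hij
    refine Metric.ball_disjoint_ball ?_
    have h1 : ‖e i - e j‖ ^ 2 = 2 := by
      rw [norm_sub_sq_real, he.1 i, he.1 j, he.2 hij]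
      norm_num
    rw [dist_eq_norm]
    nlinarith [norm_nonneg (e i - e j)]
  exact hd.countable_of_isOpen_disjoint (fun i => Metric.isOpen_ball)
    fun i => ⟨e i, Metric.mem_ball_self (by norm_num)⟩

/-- If the sums of the second moments of the coordinates of a random vector along finite
orthonormal families are bounded, then the vector is square-integrable. -/
lemma memLp_two_of_sum_integral_inner_sq_le [CompleteSpace H] [TopologicalSpace.SeparableSpace H]
    {E : Type*} [MeasurableSpace E] {ν : Measure E} {V : E → H} (hV : AEStronglyMeasurable V ν)
    (hi : ∀ h : H, Integrable (fun x => inner ℝ h (V x) ^ 2) ν) {C : ℝ}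
    (hC : ∀ {ι : Type u} [Fintype ι] (e : ι → H), Orthonormal ℝ e →
      ∑ k, ∫ x, inner ℝ (e k) (V x) ^ 2 ∂ν ≤ C) :
    MemLp V 2 ν := by
  -- The basis is indexed by a subset of `H`, so bounds over index types in the universe of `H`
  -- suffice. Its countability permits integrating Parseval's identity term by term.
  obtain ⟨w, b, -⟩ := exists_hilbertBasis ℝ H
  have : Countable w := b.orthonormal.countable_of_separableSpace
  refine ⟨hV, ?_⟩
  rw [eLpNorm_lt_top_iff_lintegral_rpow_enorm_lt_top (by simp) (by simp)]
  have hpt : ∀ x, ‖V x‖ₑ ^ (2 : ℝ) = ∑' k : w, ENNReal.ofReal (inner ℝ (b k) (V x) ^ 2) := by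
    intro x
    have hs := b.hasSum_inner_mul_inner (V x) (V x)
    have hs' : HasSum (fun k : w => inner ℝ (b k) (V x) ^ 2) (‖V x‖ ^ 2) := by
      rw [← real_inner_self_eq_norm_sq]
      simpa only [sq, real_inner_comm] using hs
    rw [← ENNReal.ofReal_tsum_of_nonneg (fun k => sq_nonneg _) hs'.summable, hs'.tsum_eq,
      ENNReal.ofReal_pow (norm_nonneg _), ofReal_norm]
    norm_cast
  simp only [ENNReal.toReal_ofNat]
  simp_rw [hpt]
  rw [lintegral_tsum fun k => (hi (b k)).aestronglyMeasurable.aemeasurable.ennreal_ofReal]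
  refine lt_of_le_of_lt ?_ (ENNReal.ofReal_lt_top (r := C))
  rw [ENNReal.tsum_eq_iSup_sum]
  refine iSup_le fun s => ?_
  have := hC (fun k : s => b k) (b.orthonormal.comp _ Subtype.val_injective)
  rw [← Finset.sum_coe_sort]
  calc _ = ∑ k : s, ENNReal.ofReal (∫ x, inner ℝ (b k) (V x) ^ 2 ∂ν) :=
        Finset.sum_congr rfl fun k _ =>
          (ofReal_integral_eq_lintegral_ofReal (hi _) (ae_of_all _ fun x => sq_nonneg _)).symm
    _ = ENNReal.ofReal (∑ k : s, ∫ x, inner ℝ (b k) (V x) ^ 2 ∂ν) := by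
        rw [ENNReal.ofReal_sum_of_nonneg fun k _ => integral_nonneg fun x => sq_nonneg _]
    _ ≤ _ := ENNReal.ofReal_le_ofReal this

end HilbertBasis

section RKHS

variable {𝕏 H : Type*} [NormedAddCommGroup H] [InnerProductSpace ℝ H] [RKHS ℝ H 𝕏 ℝ]

lemma dyadicCube_one (d : ℕ) (j : Fin d → Fin 1) : dyadicCube d 1 j = Set.univ := by
  ext s
  simp only [dyadicCube, Set.mem_ofPred_eq, Set.mem_univ, iff_true]
  intro k
  have hs := s.2 k
  have : j k = 0 := Subsingleton.elim _ _
  rw [this]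
  simp only [Fin.val_zero, Nat.cast_zero, Nat.cast_one, zero_add, div_one, true_and]
  exact ⟨hs.1, hs.2.lt_or_eq⟩

lemma fst_mem_dyadicBallClass (d : ℕ) {h : H} (hh : ‖h‖ ≤ 1) :
    (fun p : 𝕏 × UnitCube d => h p.1) ∈ dyadicBallClass H d := by
  refine ⟨h, hh, 1, le_rfl, fun _ => 0, ?_⟩
  simp [dyadicCube_one]

variable [CompleteSpace H]

lemma inner_featureMap (h : H) (x : 𝕏) : inner ℝ h (featureMap H x) = h x := by
  simp [featureMap]

/-- The range of a strongly measurable map is separable, and the kernel sections span a dense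
subspace. -/
lemma separableSpace_of_stronglyMeasurable_featureMap [MeasurableSpace 𝕏]
    (hφ : StronglyMeasurable (featureMap H : 𝕏 → H)) : TopologicalSpace.SeparableSpace H := by
  rw [← TopologicalSpace.isSeparable_univ_iff]
  refine (hφ.isSeparable_range.span (R := ℝ)).closure.mono ?_
  have hd := RKHS.kerFun_dense (𝕜 := ℝ) H (X := 𝕏) (V := ℝ)
  rw [← Submodule.topologicalClosure_coe]
  refine fun y _ => (Submodule.topologicalClosure_mono ?_ :
    _ ≤ (Submodule.span ℝ (Set.range (featureMap H : 𝕏 → H))).topologicalClosure)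
    (hd ▸ Submodule.mem_top : y ∈ _)
  rw [Submodule.span_le]
  rintro _ ⟨x, v, rfl⟩
  have : RKHS.kerFun H x v = v • featureMap H x := by
    rw [featureMap, ← map_smul]
    simp
  rw [this]
  exact Submodule.smul_mem _ _ (Submodule.subset_span ⟨x, rfl⟩)

variable [MeasurableSpace 𝕏] {d : ℕ} {ν : Measure (𝕏 × UnitCube d)} [IsProbabilityMeasure ν]

/-- Along orthonormal families, the variances of the coordinates of the feature map have bounded
sums, because they are those of a Gaussian process with bounded sample paths. -/
lemma IsDonsker.exists_sum_variance_le (hD : IsDonsker ν (dyadicBallClass H d)) :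
    ∃ C : ℝ, ∀ {ι : Type _} [Fintype ι] (e : ι → H), Orthonormal ℝ e →
      ∑ k, Var[fun p : 𝕏 × UnitCube d => e k p.1; ν] ≤ C := by
  obtain ⟨Γ, hΓ, -⟩ := hD.tendsto_law
  have := hΓ.isProbabilityMeasure
  have hC0 := stdNormalFourthMoment_nonneg
  -- a ball of large probability
  obtain ⟨m, hm⟩ : ∃ m : ℕ, Γ.real {z | ‖z‖ ≤ (m : ℝ)}ᶜ ≤
      1 / (4 * (stdNormalFourthMoment + 1)) := by
    have ht : Tendsto (fun m : ℕ => Γ.real {z | ‖z‖ ≤ (m : ℝ)}ᶜ) atTop (𝓝 0) := by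
      have h := tendsto_measure_iInter_atTop (μ := Γ)
        (s := fun m : ℕ => {z : EllInfty (dyadicBallClass H d) | ‖z‖ ≤ (m : ℝ)}ᶜ)
        (fun m => (measurableSet_le measurable_norm measurable_const).compl.nullMeasurableSet)
        (fun a b hab => Set.compl_subset_compl.2 fun z hz =>
          le_trans (show ‖z‖ ≤ (a : ℝ) from hz) (by exact_mod_cast hab)) ⟨0, measure_ne_top _ _⟩
      have hempty : ⋂ m : ℕ, {z : EllInfty (dyadicBallClass H d) | ‖z‖ ≤ (m : ℝ)}ᶜ = ∅ := by
        rw [Set.eq_empty_iff_forall_notMem]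
        intro z hz
        obtain ⟨m, hm⟩ := exists_nat_ge ‖z‖
        exact Set.mem_iInter.1 hz m hm
      rw [hempty, measure_empty] at h
      exact (ENNReal.tendsto_toReal ENNReal.zero_ne_top).comp h
    exact (ht.eventually_le_const (by positivity)).exists
  -- The radius `m` is fixed before the orthonormal family, which makes the bound uniform.
  refine ⟨2 * (m : ℝ) ^ 2, fun {ι} _ e he => ?_⟩
  classical
  set G : {h : H // ‖h‖ ≤ 1} → EllInfty (dyadicBallClass H d) → ℝ :=
    fun h z => z ⟨_, fst_mem_dyadicBallClass (𝕏 := 𝕏) d h.2⟩ with hG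
  have hlaw : ∀ h, HasGaussianLaw (G h) Γ := fun h => hΓ.isGaussian.hasGaussianLaw_eval _
  have h0 : ∀ h, ∫ z, G h z ∂Γ = 0 := fun h => hΓ.mean_eq_zero _
  have hcov : ∀ h h', cov[G h, G h'; Γ] =
      cov[fun p : 𝕏 × UnitCube d => h.1 p.1, fun p => h'.1 p.1; ν] :=
    fun h h' => hΓ.covariance_eq _ _
  have hL2 : ∀ h : {h : H // ‖h‖ ≤ 1}, MemLp (fun p : 𝕏 × UnitCube d => h.1 p.1) 2 ν :=
    fun h => hD.memLp _ (fst_mem_dyadicBallClass d h.2)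
  have hbd : ∀ h z, |G h z| ≤ ‖z‖ := fun h z => lp.norm_apply_le_norm (by simp) z _
  set ee : ι → {h : H // ‖h‖ ≤ 1} := fun k => ⟨e k, (he.1 k).le⟩ with hee
  have hsum : ∀ a : EuclideanSpace ℝ ι, ‖∑ k, a k • e k‖ = ‖a‖ := by
    intro a
    have h1 : ‖∑ k, a k • e k‖ ^ 2 = ‖a‖ ^ 2 := by
      rw [← real_inner_self_eq_norm_sq, he.inner_sum, EuclideanSpace.norm_sq_eq]
      simp [sq]
    exact (pow_left_inj₀ (norm_nonneg _) (norm_nonneg _) two_ne_zero).1 h1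
  -- The normalized combination `h` of the `e k` is again in the unit ball, hence a coordinate of
  -- the process. The relation `∑ k, a k • e k = ‖a‖ • h` passes to the paths almost surely, with
  -- `none` as the index of `h`.
  have hlin : ∀ a : EuclideanSpace ℝ ι, ∀ᵐ z ∂Γ, |∑ k, a k * G (ee k) z| ≤ ‖a‖ * ‖z‖ := by
    intro a
    rcases eq_or_ne a 0 with rfl | ha
    · simp
    have ha' : ‖a‖ ≠ 0 := norm_ne_zero_iff.2 ha
    set h : {h : H // ‖h‖ ≤ 1} := ⟨‖a‖⁻¹ • ∑ k, a k • e k, by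
      rw [norm_smul, hsum, norm_inv, norm_norm, inv_mul_cancel₀ ha']⟩ with hh
    have hrel := ae_sum_mul_eq_zero_of_covariance_eq (Γ := Γ) (ν := ν)
      (z := fun o : Option ι => G (o.elim h ee))
      (y := fun o : Option ι => fun p : 𝕏 × UnitCube d => (o.elim h ee).1 p.1)
      (fun o => (hlaw _).memLp (by simp)) (fun o => hL2 _) (fun o => h0 _)
      (fun o o' => hcov _ _) (c := fun o : Option ι => o.elim (-‖a‖) a) (by
        intro p
        rw [Fintype.sum_option]
        have : (h.1 : H) p.1 = ‖a‖⁻¹ * ∑ k, a k * e k p.1 := by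
          simp only [hh, ← inner_featureMap, inner_smul_left, sum_inner]
          simp
        simp only [Option.elim_none, Option.elim_some, this, hee]
        field_simp
        ring)
    filter_upwards [hrel] with z hz
    rw [Fintype.sum_option] at hz
    simp only [Option.elim_none, Option.elim_some] at hz
    have : ∑ k, a k * G (ee k) z = ‖a‖ * G h z := by linarith
    rw [this, abs_mul, abs_norm]
    gcongr
    exact hbd _ _
  have hR : ∀ᵐ z ∂Γ, ∑ k, G (ee k) z ^ 2 ≤ ‖z‖ ^ 2 := by
    -- The null set in `hlin` depends on `a`, so only countably many `a` may be used at once.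
    have := ae_all_iff.2 fun n => hlin (TopologicalSpace.denseSeq (EuclideanSpace ℝ ι) n)
    filter_upwards [this] with z hz
    exact sum_sq_le_of_denseRange (TopologicalSpace.denseRange_denseSeq _)
      (WithLp.toLp 2 fun k => G (ee k) z) (norm_nonneg z) hz
  have := sum_integral_sq_le_of_sum_sq_le (fun k => hlaw (ee k)) (fun k => h0 _) hR
    (measurableSet_le measurable_norm measurable_const) hm (t := (m : ℝ) ^ 2)
    (fun z hz => pow_le_pow_left₀ (norm_nonneg _) hz 2)
  refine le_trans (le_of_eq (Finset.sum_congr rfl fun k _ => ?_)) this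
  rw [← variance_of_integral_eq_zero (hlaw _).aemeasurable (h0 _),
    ← covariance_self (hlaw _).aemeasurable, hcov, covariance_self (hL2 (ee k)).aemeasurable]

/-- If the dyadic ball class is Donsker, then an integrable feature map is square-integrable. -/
lemma IsDonsker.memLp_featureMap (hD : IsDonsker ν (dyadicBallClass H d))
    (hφ : StronglyMeasurable (featureMap H : 𝕏 → H))
    (hi : Integrable (fun p : 𝕏 × UnitCube d => featureMap H p.1) ν) :
    MemLp (fun p : 𝕏 × UnitCube d => featureMap H p.1) 2 ν := by
  have := separableSpace_of_stronglyMeasurable_featureMap hφ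
  obtain ⟨C, hC⟩ := hD.exists_sum_variance_le
  have hL2 : ∀ h : H, MemLp (fun p : 𝕏 × UnitCube d => h p.1) 2 ν := by
    intro h
    rcases eq_or_ne h 0 with rfl | h0
    · simp
    have := (hD.memLp _ (fst_mem_dyadicBallClass (𝕏 := 𝕏) d (h := ‖h‖⁻¹ • h) (by
      rw [norm_smul, norm_inv, norm_norm, inv_mul_cancel₀ (norm_ne_zero_iff.2 h0)]))).const_mul ‖h‖
    refine this.congr_norm (by
      exact (((stronglyMeasurable_const (b := h)).inner
        (hφ.comp_measurable measurable_fst)).aestronglyMeasurable.congr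
          (ae_of_all _ fun p => inner_featureMap h p.1))) (ae_of_all _ fun p => ?_)
    have : (‖h‖⁻¹ • h : H) p.1 = ‖h‖⁻¹ * h p.1 := by
      simp [← inner_featureMap, inner_smul_left]
    rw [this, mul_inv_cancel_left₀ (norm_ne_zero_iff.2 h0)]
  -- Second moment is variance plus squared mean; Bessel's inequality for the Bochner mean bounds
  -- the sum of the latter.
  refine memLp_two_of_sum_integral_inner_sq_le hi.1 (fun h => ?_)
    (C := C + ‖∫ p, featureMap H p.1 ∂ν‖ ^ 2) fun {ι} _ e he => ?_
  · simp_rw [inner_featureMap]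
    exact (hL2 h).integrable_sq
  · have hk : ∀ k, ∫ p : 𝕏 × UnitCube d, inner ℝ (e k) (featureMap H p.1) ^ 2 ∂ν =
        Var[fun p : 𝕏 × UnitCube d => e k p.1; ν] +
          ‖inner ℝ (e k) (∫ p, featureMap H p.1 ∂ν)‖ ^ 2 := by
      intro k
      rw [variance_eq_sub (hL2 (e k)), ← integral_inner hi]
      simp [inner_featureMap]
    simp_rw [hk, Finset.sum_add_distrib]
    exact add_le_add (hC e he) (he.sum_inner_products_le _)

end RKHS

/-! ### Sums of independent centred vectors -/

section IdentDistrib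

variable {Ω E : Type*} [MeasurableSpace Ω] {P : Measure Ω} [MeasurableSpace E] {W₀ : Ω → E}
  {W : ℕ → Ω → E}

lemma memLp_comp_sample {F : Type*} [NormedAddCommGroup F]
    (hident : ∀ i, IdentDistrib (W i) W₀ P P)
    {f : E → F} (hf : StronglyMeasurable f) (hL : MemLp (fun ω => f (W₀ ω)) 2 P)
    (i : ℕ) : MemLp (fun ω => f (W i ω)) 2 P := by
  have h₀ := (hident i).aemeasurable_snd
  have h₁ := (hident i).aemeasurable_fst
  have := (memLp_map_measure_iff hf.aestronglyMeasurable h₀).2 hL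
  rw [← (hident i).map_eq] at this
  exact (memLp_map_measure_iff hf.aestronglyMeasurable h₁).1 this

lemma integral_comp_sample
    (hident : ∀ i, IdentDistrib (W i) W₀ P P)
    {F : Type*} [NormedAddCommGroup F] [NormedSpace ℝ F]
    {f : E → F} (hf : StronglyMeasurable f) (i : ℕ) :
    ∫ ω, f (W i ω) ∂P = ∫ ω, f (W₀ ω) ∂P := by
  rw [← integral_map (hident i).aemeasurable_fst hf.aestronglyMeasurable, (hident i).map_eq,
    integral_map (hident i).aemeasurable_snd hf.aestronglyMeasurable]

end IdentDistrib

section Independence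

variable {Ω H : Type*} [MeasurableSpace Ω] {P : Measure Ω} [IsProbabilityMeasure P]
  [NormedAddCommGroup H] [InnerProductSpace ℝ H] [CompleteSpace H]

/-- The cross terms vanish by independence and centring. -/
lemma integral_norm_sum_sq_of_pairwise_indepFun [MeasurableSpace H] [BorelSpace H] {ι : Type*}
    (s : Finset ι) {V : ι → Ω → H} (hV : ∀ i, MemLp (V i) 2 P) (h0 : ∀ i, ∫ ω, V i ω ∂P = 0)
    (hind : Pairwise fun i j => IndepFun (V i) (V j) P) :
    ∫ ω, ‖∑ i ∈ s, V i ω‖ ^ 2 ∂P = ∑ i ∈ s, ∫ ω, ‖V i ω‖ ^ 2 ∂P := by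
  classical
  have hint : ∀ i j, Integrable (fun ω => inner ℝ (V i ω) (V j ω)) P :=
    fun i j =>
    ((hV i).norm.integrable_mul (hV j).norm).mono' ((hV i).1.inner (hV j).1)
      (ae_of_all _ fun ω => norm_inner_le_norm _ _)
  have hoff : ∀ i j, i ≠ j → ∫ ω, inner ℝ (V i ω) (V j ω) ∂P = 0 := by
    intro i j hij
    have := (hind hij).integral_bilin ((hV i).integrable (by simp)) ((hV j).integrable (by simp))
      (innerSL ℝ)
    simpa only [h0, map_zero, innerSL_apply_apply ℝ] using this
  calc ∫ ω, ‖∑ i ∈ s, V i ω‖ ^ 2 ∂P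
      = ∫ ω, ∑ i ∈ s, ∑ j ∈ s, inner ℝ (V i ω) (V j ω) ∂P := by
        congr 1 with ω
        rw [← real_inner_self_eq_norm_sq, sum_inner]
        simp_rw [inner_sum]
    _ = ∑ i ∈ s, ∑ j ∈ s, ∫ ω, inner ℝ (V i ω) (V j ω) ∂P := by
        rw [integral_finsetSum _ fun i _ => integrable_finsetSum _ fun j _ => hint i j]
        exact Finset.sum_congr rfl fun i _ => integral_finsetSum _ fun j _ => hint i j
    _ = ∑ i ∈ s, ∫ ω, ‖V i ω‖ ^ 2 ∂P := by
        refine Finset.sum_congr rfl fun i hi => ?_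
        rw [Finset.sum_eq_single i (fun j _ hj => hoff i j hj.symm) (fun h => absurd hi h)]
        simp_rw [real_inner_self_eq_norm_sq]

variable {E : Type*} [MeasurableSpace E] {W₀ : Ω → E} {W : ℕ → Ω → E}

lemma integral_norm_sum_sample_sq
    (hindep : iIndepFun (fun o : Option ℕ => o.elim W₀ W) P)
    (hident : ∀ i, IdentDistrib (W i) W₀ P P)
    {f : E → H} (hf : StronglyMeasurable f)
    (hL : MemLp (fun ω => f (W₀ ω)) 2 P) (h0 : ∫ ω, f (W₀ ω) ∂P = 0) (n : ℕ) :
    ∫ ω, ‖∑ i ∈ Finset.range n, f (W i ω)‖ ^ 2 ∂P = n * ∫ ω, ‖f (W₀ ω)‖ ^ 2 ∂P := by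
  borelize H
  rw [integral_norm_sum_sq_of_pairwise_indepFun (P := P) _
    (memLp_comp_sample hident hf hL) (fun i => by rw [integral_comp_sample hident hf, h0])]
  · have h2 : StronglyMeasurable fun x => ‖f x‖ ^ 2 := hf.norm.pow 2
    rw [Finset.sum_congr rfl fun i _ => integral_comp_sample hident h2 i]
    simp
  · intro i j hij
    have := hindep.indepFun (i := some i) (j := some j) (by simpa using hij)
    exact this.comp hf.measurable hf.measurable

/-- The point `W₀` (index `none`) is independent of the sample (indices `some i`), so the
probability of its cell factors out. This factor later cancels one of the two factors `p_j` in the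
denominator. -/
lemma integral_indicator_mul_norm_sum_sample_sq
    (hindep : iIndepFun (fun o : Option ℕ => o.elim W₀ W) P)
    (hident : ∀ i, IdentDistrib (W i) W₀ P P)
    {f : E → H} (hf : StronglyMeasurable f)
    (hL : MemLp (fun ω => f (W₀ ω)) 2 P) (h0 : ∫ ω, f (W₀ ω) ∂P = 0) (n : ℕ) {A : Set E}
    (hA : MeasurableSet A) :
    Integrable (fun ω => A.indicator (fun _ => (1 : ℝ)) (W₀ ω) *
      ‖∑ i ∈ Finset.range n, f (W i ω)‖ ^ 2) P ∧
    ∫ ω, A.indicator (fun _ => (1 : ℝ)) (W₀ ω) * ‖∑ i ∈ Finset.range n, f (W i ω)‖ ^ 2 ∂P =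
      P.real (W₀ ⁻¹' A) * (n * ∫ ω, ‖f (W₀ ω)‖ ^ 2 ∂P) := by
  borelize H
  have hW₀ : AEMeasurable W₀ P := (hident 0).aemeasurable_snd
  have hmeas : ∀ o : Option ℕ, AEMeasurable (o.elim W₀ W) P := by
    rintro (_ | i)
    · exact hW₀
    · exact (hident i).aemeasurable_fst
  set T : Finset (Option ℕ) := (Finset.range n).map Function.Embedding.some with hT
  have hdisj : Disjoint ({none} : Finset (Option ℕ)) T := by
    simp [hT]
  have hI := hindep.indepFun_finset₀ {none} T hdisj hmeas
  have hind : IndepFun (fun ω => A.indicator (fun _ => (1 : ℝ)) (W₀ ω))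
      (fun ω => ‖∑ i ∈ Finset.range n, f (W i ω)‖ ^ 2) P := by
    have := hI.comp (γ := ℝ) (γ' := ℝ) (_mγ := Real.measurableSpace)
      (_mγ' := Real.measurableSpace) (φ := fun w : ({none} : Finset (Option ℕ)) → E => A.indicator (fun _ => (1 : ℝ)) (w ⟨none, by simp⟩))
      (ψ := fun w : T → E => ‖∑ i : T, f (w i)‖ ^ 2)
      ((measurable_const.indicator hA).comp (measurable_pi_apply _))
      ((Finset.stronglyMeasurable_fun_sum Finset.univ fun i _ =>
        hf.comp_measurable (measurable_pi_apply i)).norm.measurable.pow_const 2)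
    convert this using 1
    · rfl
    funext ω
    change _ = ‖∑ i : T, f ((i : Option ℕ).elim W₀ W ω)‖ ^ 2
    rw [Finset.sum_coe_sort T (fun o => f (o.elim W₀ W ω)), hT, Finset.sum_map]
    rfl
  have hsum : MemLp (fun ω => ∑ i ∈ Finset.range n, f (W i ω)) 2 P :=
    memLp_finsetSum _ fun i _ => memLp_comp_sample hident hf hL i
  have hA' : NullMeasurableSet (W₀ ⁻¹' A) P := hW₀.nullMeasurableSet_preimage hA
  have hiA : Integrable (fun ω => A.indicator (fun _ => (1 : ℝ)) (W₀ ω)) P :=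
    (integrable_const (1 : ℝ)).indicator₀ hA'
  refine ⟨hind.integrable_mul hiA hsum.integrable_norm_pow', ?_⟩
  rw [hind.integral_fun_mul_eq_mul_integral hiA.1 hsum.integrable_norm_pow'.1,
    integral_norm_sum_sample_sq hindep hident hf hL h0]
  congr 1
  have : (fun ω => A.indicator (fun _ => (1 : ℝ)) (W₀ ω)) =
      (W₀ ⁻¹' A).indicator fun _ => (1 : ℝ) := rfl
  rw [this, integral_indicator₀ hA', setIntegral_const]
  simp

/-- Chebyshev: the number of observations in `A` is rarely less than half its expectation. -/
lemma measure_count_lt_le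
    (hindep : iIndepFun (fun o : Option ℕ => o.elim W₀ W) P)
    (hident : ∀ i, IdentDistrib (W i) W₀ P P)
    {A : Set E} (hA : MeasurableSet A) (hp : 0 < P.real (W₀ ⁻¹' A)) {n : ℕ}
    (hn : 1 ≤ n) :
    P {ω | ∑ i ∈ Finset.range n, A.indicator (fun _ => (1 : ℝ)) (W i ω) <
      n * P.real (W₀ ⁻¹' A) / 2} ≤ ENNReal.ofReal (4 / (n * P.real (W₀ ⁻¹' A))) := by
  set p := P.real (W₀ ⁻¹' A) with hpdef
  have hn' : (0 : ℝ) < n := by exact_mod_cast hn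
  have hW₀ : AEMeasurable W₀ P := (hident 0).aemeasurable_snd
  have hA' : NullMeasurableSet (W₀ ⁻¹' A) P := hW₀.nullMeasurableSet_preimage hA
  set χ : E → ℝ := A.indicator (fun _ => (1 : ℝ)) with hχ
  have hχm : StronglyMeasurable χ := stronglyMeasurable_const.indicator hA
  have hiA : Integrable (fun ω => χ (W₀ ω)) P := (integrable_const (1 : ℝ)).indicator₀ hA'
  have hint : ∫ ω, χ (W₀ ω) ∂P = p := by
    have : (fun ω => χ (W₀ ω)) = (W₀ ⁻¹' A).indicator fun _ => (1 : ℝ) := rfl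
    rw [this, integral_indicator₀ hA', setIntegral_const]
    simp [hpdef]
  have hχb : ∀ x, |χ x| ≤ 1 := fun x => by
    by_cases hx : x ∈ A <;> simp [hχ, hx]
  have hχL : MemLp (fun ω => χ (W₀ ω)) 2 P :=
    MemLp.of_bound hiA.1 1 (ae_of_all _ fun ω => hχb _)
  set f : E → ℝ := fun x => χ x - p with hf
  have hfm : StronglyMeasurable f := hχm.sub stronglyMeasurable_const
  have hfL : MemLp (fun ω => f (W₀ ω)) 2 P := hχL.sub (memLp_const p)
  have hf0 : ∫ ω, f (W₀ ω) ∂P = 0 := by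
    simp only [hf]
    rw [integral_sub hiA (integrable_const _), hint]
    simp
  have hf2 : ∫ ω, ‖f (W₀ ω)‖ ^ 2 ∂P ≤ p := by
    have : ∀ x, ‖f x‖ ^ 2 = χ x - 2 * p * χ x + p ^ 2 := by
      intro x
      rw [Real.norm_eq_abs, sq_abs]
      by_cases hx : x ∈ A
      · simp [hf, hχ, hx]
        ring
      · simp [hf, hχ, hx]
    simp_rw [this]
    rw [integral_add (f := fun ω => χ (W₀ ω) - 2 * p * χ (W₀ ω)) (hiA.sub (hiA.const_mul _))
      (integrable_const _), integral_sub hiA (hiA.const_mul _), integral_const_mul, hint]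
    simp
    nlinarith
  have hsum : MemLp (fun ω => ∑ i ∈ Finset.range n, f (W i ω)) 2 P :=
    memLp_finsetSum _ fun i _ => memLp_comp_sample hident hfm hfL i
  have hI := integral_norm_sum_sample_sq hindep hident hfm hfL hf0 n
  -- Such a count deviates from its mean `n p` by more than `n p / 2`, while its variance is at most
  -- `n p`.
  have hsub : {ω | ∑ i ∈ Finset.range n, χ (W i ω) < n * p / 2} ⊆
      {ω | (n * p / 2) ^ 2 ≤ ‖∑ i ∈ Finset.range n, f (W i ω)‖ ^ 2} := by
    intro ω hω
    have hω' : ∑ i ∈ Finset.range n, χ (W i ω) < n * p / 2 := hω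
    change (n * p / 2) ^ 2 ≤ ‖∑ i ∈ Finset.range n, f (W i ω)‖ ^ 2
    simp only [hf, Finset.sum_sub_distrib, Finset.sum_const, Finset.card_range, nsmul_eq_mul,
      Real.norm_eq_abs, sq_abs]
    rw [← neg_sq (_ - _)]
    have : 0 < n * p := by positivity
    exact pow_le_pow_left₀ (by positivity) (by linarith) 2
  have hmk := mul_meas_ge_le_integral_of_nonneg (μ := P)
    (f := fun ω => ‖∑ i ∈ Finset.range n, f (W i ω)‖ ^ 2)
    (ae_of_all _ fun ω => by positivity) hsum.integrable_norm_pow' ((n * p / 2) ^ 2)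
  rw [hI] at hmk
  refine (measure_mono hsub).trans ?_
  rw [← ofReal_measureReal]
  refine ENNReal.ofReal_le_ofReal ?_
  have hle : (n * p / 2) ^ 2 * P.real {ω | (n * p / 2) ^ 2 ≤
      ‖∑ i ∈ Finset.range n, f (W i ω)‖ ^ 2} ≤ n * p :=
    hmk.trans (by gcongr)
  rw [← le_div_iff₀' (by positivity)] at hle
  refine hle.trans (le_of_eq ?_)
  field_simp
  norm_num

end Independence

/-! ### Markov's inequality for the conditional `L²` norm -/

/-- Since `G` belongs to `m`, the conditional expectation has the same integral over `G` as `‖Z‖²`.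
Markov's inequality is applied to the restriction of `P` to `G`. -/
lemma measure_lt_condL2Norm_le {Ω H : Type*} {m mΩ : MeasurableSpace Ω} {P : Measure Ω}
    [IsProbabilityMeasure P] [NormedAddCommGroup H] [InnerProductSpace ℝ H] (hm : m ≤ mΩ)
    (Z : Ω → H) {G : Set Ω} (hG : MeasurableSet[m] G) {t : ℝ} (ht : 0 < t) :
    P {ω | ENNReal.ofReal t < condL2Norm P m Z ω} ≤
      P Gᶜ + (∫⁻ ω in G, ‖Z ω‖ₑ ^ 2 ∂P) / ENNReal.ofReal (t ^ 2) := by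
  set F := condLExp m P (fun ω => ‖Z ω‖ₑ ^ 2) with hF
  have hsub : {ω | ENNReal.ofReal t < condL2Norm P m Z ω} ⊆
      Gᶜ ∪ ({ω | ENNReal.ofReal (t ^ 2) ≤ F ω} ∩ G) := by
    intro ω hω
    by_cases hωG : ω ∈ G
    · refine Or.inr ⟨?_, hωG⟩
      have h1 : ENNReal.ofReal t < F ω ^ (1 / 2 : ℝ) := hω
      change ENNReal.ofReal (t ^ 2) ≤ F ω
      rw [ENNReal.ofReal_pow ht.le]
      calc ENNReal.ofReal t ^ 2 ≤ (F ω ^ (1 / 2 : ℝ)) ^ 2 := by gcongr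
        _ = F ω := by
          rw [← ENNReal.rpow_natCast, ← ENNReal.rpow_mul]
          norm_num
    · exact Or.inl hωG
  refine (measure_mono hsub).trans ((measure_union_le _ _).trans ?_)
  gcongr
  rw [← Measure.restrict_apply' (hm _ hG)]
  refine (meas_ge_le_lintegral_div (by fun_prop) (by positivity) ENNReal.ofReal_ne_top).trans ?_
  rw [hF, setLIntegral_condLExp hm P _ hG]

/-! ### Geometry of the cubes -/

section Cubes

variable {d ℓ : ℕ}

lemma measurable_unitCube_coord (k : Fin d) : Measurable fun s : UnitCube d => s.1 k :=
  ((EuclideanSpace.proj (𝕜 := ℝ) k).continuous.comp continuous_subtype_val).measurable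

lemma measurableSet_dyadicCube (j : Fin d → Fin ℓ) : MeasurableSet (dyadicCube d ℓ j) := by
  refine MeasurableSet.congr (s := ⋂ k, {s : UnitCube d | ((j k : ℕ) : ℝ) / ℓ ≤ s.1 k ∧
    (s.1 k < (((j k : ℕ) : ℝ) + 1) / ℓ ∨ ((j k : ℕ) + 1 = ℓ ∧ s.1 k = 1))})
    (MeasurableSet.iInter fun k => ?_) (by ext; simp [dyadicCube])
  have hk := measurable_unitCube_coord k
  exact (measurableSet_le measurable_const hk).inter
    ((measurableSet_lt hk measurable_const).union
      ((MeasurableSet.const _).inter (measurableSet_eq_fun hk measurable_const)))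

lemma exists_mem_dyadicCube (hℓ : 1 ≤ ℓ) (s : UnitCube d) : ∃ j, s ∈ dyadicCube d ℓ j := by
  have hℓ' : (0 : ℝ) < ℓ := by exact_mod_cast hℓ
  -- The minimum matters only at `s k = 1`, where the floor is `ℓ` and the last cube contains the
  -- upper face.
  refine ⟨fun k => ⟨min ⌊s.1 k * ℓ⌋₊ (ℓ - 1), by omega⟩, fun k => ?_⟩
  have hs := s.2 k
  have h0 : 0 ≤ s.1 k * ℓ := mul_nonneg hs.1 hℓ'.le
  rw [div_le_iff₀ hℓ', lt_div_iff₀ hℓ']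
  refine ⟨?_, ?_⟩
  · refine le_trans ?_ (Nat.floor_le h0)
    exact_mod_cast min_le_left _ _
  · rcases hs.2.lt_or_eq with h | h
    · left
      have : ⌊s.1 k * ℓ⌋₊ < ℓ := by
        rw [Nat.floor_lt h0]
        nlinarith
      simp only
      rw [min_eq_left (by omega)]
      exact Nat.lt_floor_add_one _
    · right
      refine ⟨?_, h⟩
      simp only [h, one_mul, Nat.floor_natCast]
      omega

lemma eq_of_mem_dyadicCube {s : UnitCube d} {i j : Fin d → Fin ℓ} (hi : s ∈ dyadicCube d ℓ i)
    (hj : s ∈ dyadicCube d ℓ j) : i = j := by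
  have key : ∀ {i j : Fin d → Fin ℓ}, s ∈ dyadicCube d ℓ i → s ∈ dyadicCube d ℓ j →
      ∀ k, (i k : ℕ) ≤ j k := by
    intro i j hi hj k
    have hlt := (i k).2
    have hℓ' : (0 : ℝ) < ℓ := by exact_mod_cast (by omega : 0 < ℓ)
    have h1 := (hi k).1
    rcases (hj k).2 with h2 | ⟨h2, -⟩
    · have := h1.trans_lt h2
      rw [div_lt_div_iff_of_pos_right hℓ'] at this
      have : (i k : ℕ) < (j k : ℕ) + 1 := by exact_mod_cast this
      omega
    · omega
  funext k
  exact Fin.ext (le_antisymm (key hi hj k) (key hj hi k))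

lemma dist_le_of_mem_dyadicCube {j : Fin d → Fin ℓ} {s t : UnitCube d}
    (hs : s ∈ dyadicCube d ℓ j) (ht : t ∈ dyadicCube d ℓ j) : dist s t ≤ √d / ℓ := by
  have hk : ∀ k, |s.1 k - t.1 k| ≤ 1 / ℓ := by
    intro k
    have hlt := (j k).2
    have hℓ' : (0 : ℝ) < ℓ := by exact_mod_cast (by omega : 0 < ℓ)
    have hup : ∀ {s : UnitCube d}, s ∈ dyadicCube d ℓ j → s.1 k ≤ (((j k : ℕ) : ℝ) + 1) / ℓ := by
      intro s hs
      rcases (hs k).2 with h | ⟨h, h'⟩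
      · exact h.le
      · rw [h', le_div_iff₀ hℓ', one_mul]
        exact_mod_cast h.ge
    have h1 := (hs k).1
    have h2 := (ht k).1
    have h3 := hup hs
    have h4 := hup ht
    rw [add_div] at h3 h4
    rw [abs_le]
    constructor <;> linarith
  rw [Subtype.dist_eq, EuclideanSpace.dist_eq]
  calc √(∑ k, dist (s.1 k) (t.1 k) ^ 2) ≤ √(∑ _k : Fin d, (1 / (ℓ : ℝ)) ^ 2) := by
        gcongr with k
        rw [Real.dist_eq]
        exact hk k
    _ = √d / ℓ := by
        rw [Finset.sum_const, Finset.card_univ, Fintype.card_fin, nsmul_eq_mul,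
          Real.sqrt_mul (by positivity), Real.sqrt_sq (by positivity)]
        ring

/-- The cube contains a half-open box of volume `ℓ ^ (-d)`; possible upper faces can be ignored for
a lower bound. -/
lemma ofReal_le_cubeVolume_dyadicCube (j : Fin d → Fin ℓ) :
    ENNReal.ofReal (1 / (ℓ : ℝ) ^ d) ≤ cubeVolume d (dyadicCube d ℓ j) := by
  set B : Set (Fin d → ℝ) :=
    Set.univ.pi fun k => Set.Ico (((j k : ℕ) : ℝ) / ℓ) ((((j k : ℕ) : ℝ) + 1) / ℓ)
  have hvol : volume (WithLp.ofLp ⁻¹' B : Set (EuclideanSpace ℝ (Fin d))) =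
      ENNReal.ofReal (1 / (ℓ : ℝ) ^ d) := by
    rw [(PiLp.volume_preserving_ofLp (Fin d)).measure_preimage
      (MeasurableSet.univ_pi fun k => measurableSet_Ico).nullMeasurableSet, Real.volume_pi_Ico]
    simp only [add_div, add_sub_cancel_left]
    rw [Finset.prod_const, Finset.card_univ, Fintype.card_fin, ← ENNReal.ofReal_pow (by positivity)]
    simp
  have hcl : MeasurableSet ({s | ∀ k, s k ∈ Set.Icc (0 : ℝ) 1} : Set (EuclideanSpace ℝ (Fin d))) := by
    rw [Set.ofPred_forall]
    refine MeasurableSet.iInter fun k => ?_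
    exact (EuclideanSpace.proj (𝕜 := ℝ) k).continuous.measurable measurableSet_Icc
  rw [← hvol, cubeVolume,
    (MeasurableEmbedding.subtype_coe hcl).comap_apply]
  refine measure_mono fun x hx => ?_
  have hx' : ∀ k, ((j k : ℕ) : ℝ) / ℓ ≤ x k ∧ x k < (((j k : ℕ) : ℝ) + 1) / ℓ :=
    fun k => hx k (Set.mem_univ k)
  refine ⟨⟨x, fun k => ?_⟩, fun k => ⟨(hx' k).1, Or.inl (hx' k).2⟩, rfl⟩
  have hlt := (j k).2
  have hℓ' : (0 : ℝ) < ℓ := by exact_mod_cast (by omega : 0 < ℓ)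
  refine ⟨le_trans (by positivity) (hx' k).1, (hx' k).2.le.trans ?_⟩
  rw [div_le_one hℓ']
  exact_mod_cast hlt

/-- A law with density at least `b` gives each cube of side length `1 / ℓ` mass at least
`b / ℓ ^ d`. -/
lemma le_measureReal_preimage_dyadicCube {Ω : Type*} [MeasurableSpace Ω] {P : Measure Ω}
    [IsFiniteMeasure P] {S : Ω → UnitCube d} (hS : Measurable S) {u : UnitCube d → ℝ≥0∞}
    (hdensity : P.map S = (cubeVolume d).withDensity u) {b : ℝ} (hb : 0 ≤ b)
    (hub : ∀ s, ENNReal.ofReal b ≤ u s) (j : Fin d → Fin ℓ) :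
    b / (ℓ : ℝ) ^ d ≤ P.real (S ⁻¹' dyadicCube d ℓ j) := by
  have hm := measurableSet_dyadicCube j
  have h : ENNReal.ofReal (b / (ℓ : ℝ) ^ d) ≤ P (S ⁻¹' dyadicCube d ℓ j) := by
    rw [← Measure.map_apply hS hm, hdensity, withDensity_apply _ hm]
    calc ENNReal.ofReal (b / (ℓ : ℝ) ^ d)
        = ENNReal.ofReal b * ENNReal.ofReal (1 / (ℓ : ℝ) ^ d) := by
          rw [← ENNReal.ofReal_mul hb, mul_one_div]
      _ ≤ ENNReal.ofReal b * cubeVolume d (dyadicCube d ℓ j) := by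
          gcongr
          exact ofReal_le_cubeVolume_dyadicCube j
      _ = ∫⁻ _s in dyadicCube d ℓ j, ENNReal.ofReal b ∂(cubeVolume d) := by
          rw [setLIntegral_const]
      _ ≤ _ := lintegral_mono fun s => hub s
  exact (ENNReal.ofReal_le_iff_le_toReal (measure_ne_top _ _)).1 h

end Cubes

/-! ### Bias of the cell means -/

/-- The mean of `V` given `S ∈ B`. -/
noncomputable def cellMean {Ω 𝕊 H : Type*} [MeasurableSpace Ω] [NormedAddCommGroup H]
    [NormedSpace ℝ H] (P : Measure Ω) (V : Ω → H) (S : Ω → 𝕊) (B : Set 𝕊) : H :=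
  (P.real (S ⁻¹' B))⁻¹ • ∫ ω in S ⁻¹' B, V ω ∂P

/-- The event `S ∈ B` lies in `σ(S)`, so the cell mean is the average of `g ∘ S` over it, and all
values of `g` on `B` are within `L * D` of `g s`. -/
lemma norm_cellMean_sub_le {Ω 𝕊 H : Type*} [MeasurableSpace Ω] [PseudoMetricSpace 𝕊]
    [MeasurableSpace 𝕊] [NormedAddCommGroup H] [NormedSpace ℝ H] [CompleteSpace H]
    {P : Measure Ω} [IsFiniteMeasure P] {V : Ω → H} (hV : Integrable V P) {S : Ω → 𝕊}
    (hS : Measurable S) {g : 𝕊 → H} {L : ℝ≥0} (hgL : LipschitzWith L g)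
    (hg : P[V | MeasurableSpace.comap S inferInstance] =ᵐ[P] g ∘ S) {B : Set 𝕊}
    (hB : MeasurableSet B) (hp : 0 < P.real (S ⁻¹' B)) {D : ℝ}
    (hD : ∀ s ∈ B, ∀ t ∈ B, dist s t ≤ D) {s : 𝕊} (hs : s ∈ B) :
    ‖cellMean P V S B - g s‖ ≤ L * D := by
  set A := S ⁻¹' B with hA
  have hAm : MeasurableSet A := hS hB
  have hgi : Integrable (g ∘ S) P := integrable_condExp.congr hg
  have h1 : ∫ ω in A, V ω ∂P = ∫ ω in A, g (S ω) ∂P := by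
    rw [← setIntegral_condExp hS.comap_le hV ⟨B, hB, rfl⟩]
    exact integral_congr_ae (ae_restrict_of_ae hg)
  have h2 : cellMean P V S B - g s = (P.real A)⁻¹ • ∫ ω in A, (g (S ω) - g s) ∂P := by
    rw [integral_sub (f := fun ω => g (S ω)) hgi.integrableOn (integrable_const _), setIntegral_const, smul_sub,
      inv_smul_smul₀ hp.ne', ← h1, cellMean]
  rw [h2, norm_smul, norm_inv, Real.norm_of_nonneg hp.le, inv_mul_le_iff₀ hp, mul_comm]
  refine norm_setIntegral_le_of_norm_le_const (measure_lt_top _ _) fun ω hω => ?_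
  rw [← dist_eq_norm]
  exact (hgL.dist_le_mul _ _).trans (by gcongr; exact hD _ hω _ hs)

/-! ### Error of the plug-in estimator -/

section PlugIn

variable {Ω 𝕏 𝕊 H : Type*} [NormedAddCommGroup H] [InnerProductSpace ℝ H]

/-- The deviation of the feature `φ x` from the vector `m`, restricted to the cell `B`. -/
noncomputable def cellDeviation (φ : 𝕏 → H) (m : H) (B : Set 𝕊) (p : 𝕏 × 𝕊) : H :=
  B.indicator (fun _ => (1 : ℝ)) p.2 • (φ p.1 - m)

lemma stronglyMeasurable_cellDeviation [MeasurableSpace 𝕏] [MeasurableSpace 𝕊] {φ : 𝕏 → H} (hφ : StronglyMeasurable φ) (m : H) {B : Set 𝕊}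
    (hB : MeasurableSet B) : StronglyMeasurable (cellDeviation φ m B) :=
  ((stronglyMeasurable_const.indicator hB).comp_measurable measurable_snd).smul
    ((hφ.comp_measurable measurable_fst).sub stronglyMeasurable_const)

lemma cellDeviation_eq_indicator (φ : 𝕏 → H) (m : H) (B : Set 𝕊) (X : Ω → 𝕏) (S : Ω → 𝕊) :
    (fun ω => cellDeviation φ m B (X ω, S ω)) = (S ⁻¹' B).indicator fun ω => φ (X ω) - m := by
  funext ω
  by_cases h : S ω ∈ B
  · simp [cellDeviation, h]
  · simp [cellDeviation, h]

section Moments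

variable [MeasurableSpace Ω] [MeasurableSpace 𝕊] {P : Measure Ω} [IsProbabilityMeasure P]
  {φ : 𝕏 → H} {X : Ω → 𝕏} {S : Ω → 𝕊} {B : Set 𝕊}

lemma memLp_cellDeviation (hL : MemLp (fun ω => φ (X ω)) 2 P) (hS : Measurable S)
    (hB : MeasurableSet B) (m : H) : MemLp (fun ω => cellDeviation φ m B (X ω, S ω)) 2 P := by
  rw [cellDeviation_eq_indicator]
  exact (hL.sub (memLp_const m)).indicator (hS hB)

variable [CompleteSpace H]

lemma integral_cellDeviation_cellMean (hL : MemLp (fun ω => φ (X ω)) 2 P) (hS : Measurable S)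
    (hB : MeasurableSet B) (hp : 0 < P.real (S ⁻¹' B)) :
    ∫ ω, cellDeviation φ (cellMean P (fun ω => φ (X ω)) S B) B (X ω, S ω) ∂P = 0 := by
  have hi := hL.integrable (by simp)
  rw [cellDeviation_eq_indicator, integral_indicator (hS hB),
    integral_sub hi.integrableOn (integrable_const _), setIntegral_const, cellMean,
    smul_inv_smul₀ hp.ne', sub_self]

/-- Centring at the cell mean `m` only lowers the second moment, by `P(S ∈ B) ‖m‖²`. -/
lemma integral_norm_cellDeviation_cellMean_sq_le (hL : MemLp (fun ω => φ (X ω)) 2 P)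
    (hS : Measurable S) (hB : MeasurableSet B) (hp : 0 < P.real (S ⁻¹' B)) :
    ∫ ω, ‖cellDeviation φ (cellMean P (fun ω => φ (X ω)) S B) B (X ω, S ω)‖ ^ 2 ∂P ≤
      ∫ ω, B.indicator (fun _ => (1 : ℝ)) (S ω) * ‖φ (X ω)‖ ^ 2 ∂P := by
  set m := cellMean P (fun ω => φ (X ω)) S B with hm
  have hi := hL.integrable (by simp)
  have hi2 := hL.integrable_norm_pow'
  have hA := hS hB
  have e1 : (fun ω => ‖cellDeviation φ m B (X ω, S ω)‖ ^ 2) =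
      (S ⁻¹' B).indicator fun ω => ‖φ (X ω) - m‖ ^ 2 := by
    funext ω
    by_cases h : S ω ∈ B <;> simp [cellDeviation, h]
  have e2 : (fun ω => B.indicator (fun _ => (1 : ℝ)) (S ω) * ‖φ (X ω)‖ ^ 2) =
      (S ⁻¹' B).indicator fun ω => ‖φ (X ω)‖ ^ 2 := by
    funext ω
    by_cases h : S ω ∈ B <;> simp [h]
  have hmean : ∫ ω in S ⁻¹' B, φ (X ω) ∂P = P.real (S ⁻¹' B) • m := by
    rw [hm, cellMean, smul_inv_smul₀ hp.ne']
  have hii : Integrable (fun ω => inner ℝ m (φ (X ω))) P := hi.const_inner m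
  rw [e1, e2, integral_indicator hA, integral_indicator hA]
  have e3 : ∀ ω, ‖φ (X ω) - m‖ ^ 2 = ‖φ (X ω)‖ ^ 2 - 2 * inner ℝ m (φ (X ω)) + ‖m‖ ^ 2 := by
    intro ω
    rw [norm_sub_sq_real, real_inner_comm]
  have hdiff : Integrable (fun ω => ‖φ (X ω)‖ ^ 2 - 2 * inner ℝ m (φ (X ω)))
      (P.restrict (S ⁻¹' B)) := (hi2.sub (hii.const_mul 2)).integrableOn
  simp_rw [e3]
  rw [integral_add (f := fun ω => ‖φ (X ω)‖ ^ 2 - 2 * inner ℝ m (φ (X ω)))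
      hdiff (integrable_const _),
    integral_sub hi2.integrableOn (hii.const_mul 2).integrableOn, integral_const_mul,
    integral_inner hi.integrableOn, hmean, setIntegral_const, inner_smul_right,
    real_inner_self_eq_norm_sq, smul_eq_mul]
  have : 0 ≤ P.real (S ⁻¹' B) * ‖m‖ ^ 2 := by positivity
  linarith

end Moments

/-- In a cell with `N > 0` observations the error is exactly `N⁻¹` times the sum of the deviations.
-/
lemma norm_empiricalCondMean_sub_sq_le (φ : 𝕏 → H) (Xs : ℕ → Ω → 𝕏) (Ss : ℕ → Ω → 𝕊) {n : ℕ}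
    (hn : 1 ≤ n) (B : Set 𝕊) (ω : Ω) (m : H) {c : ℝ} (hc : 0 < c)
    (hN : c ≤ ∑ i ∈ Finset.range n, B.indicator (fun _ => (1 : ℝ)) (Ss i ω)) :
    ‖empiricalCondMean φ Xs Ss n B ω - m‖ ^ 2 ≤
      ‖∑ i ∈ Finset.range n, cellDeviation φ m B (Xs i ω, Ss i ω)‖ ^ 2 / c ^ 2 := by
  set N := ∑ i ∈ Finset.range n, B.indicator (fun _ => (1 : ℝ)) (Ss i ω) with hNdef
  have hn' : (0 : ℝ) < n := by exact_mod_cast hn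
  have hN0 : 0 < N := hc.trans_le hN
  have hE : empiricalProb Ss n B ω = 1 / n * N := rfl
  have hpos : 0 < empiricalProb Ss n B ω := by
    rw [hE]
    positivity
  have hnE : n * empiricalProb Ss n B ω = N := by
    rw [hE]
    field_simp
  have key : empiricalCondMean φ Xs Ss n B ω - m =
      N⁻¹ • ∑ i ∈ Finset.range n, cellDeviation φ m B (Xs i ω, Ss i ω) := by
    rw [empiricalCondMean, if_pos hpos, hnE]
    simp only [cellDeviation, smul_sub, Finset.sum_sub_distrib]
    rw [← Finset.sum_smul, ← hNdef, inv_smul_smul₀ hN0.ne', one_div]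
  rw [key, norm_smul, norm_inv, Real.norm_of_nonneg hN0.le, mul_pow, inv_pow, inv_mul_eq_div]
  gcongr

/-- A nonzero count is at least `1`, so the weights never exceed `1`. This crude bound serves to
make the mean square error finite for each fixed `n`. -/
lemma norm_empiricalCondMean_le (φ : 𝕏 → H) (Xs : ℕ → Ω → 𝕏) (Ss : ℕ → Ω → 𝕊) (n : ℕ) (B : Set 𝕊)
    (ω : Ω) : ‖empiricalCondMean φ Xs Ss n B ω‖ ≤ ∑ i ∈ Finset.range n, ‖φ (Xs i ω)‖ := by
  have hs0 : 0 ≤ ∑ i ∈ Finset.range n, ‖φ (Xs i ω)‖ := Finset.sum_nonneg fun i _ => norm_nonneg _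
  rw [empiricalCondMean]
  split_ifs with h
  swap
  · simpa using hs0
  rcases n.eq_zero_or_pos with rfl | hn
  · simp
  have hn' : (0 : ℝ) < n := by exact_mod_cast hn
  have hnE : n * empiricalProb Ss n B ω =
      ∑ i ∈ Finset.range n, B.indicator (fun _ => (1 : ℝ)) (Ss i ω) := by
    rw [empiricalProb]
    field_simp
  have hN0 : 0 < n * empiricalProb Ss n B ω := by positivity
  have hN1 : 1 ≤ n * empiricalProb Ss n B ω := by
    rw [hnE] at hN0 ⊢
    obtain ⟨i, hi, hpos⟩ := Finset.exists_lt_of_sum_lt (s := Finset.range n) (f := fun _ => (0 : ℝ))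
      (by simpa using hN0)
    have hiB : Ss i ω ∈ B := by
      by_contra hcon
      simp [hcon] at hpos
    have := Finset.single_le_sum (s := Finset.range n)
      (f := fun i => B.indicator (fun _ => (1 : ℝ)) (Ss i ω))
      (fun i _ => Set.indicator_nonneg (fun _ _ => zero_le_one) _) hi
    simpa [hiB] using this
  rw [norm_smul, Real.norm_of_nonneg (by positivity)]
  have hsum : ‖∑ i ∈ Finset.range n, B.indicator (fun _ => (1 : ℝ)) (Ss i ω) • φ (Xs i ω)‖ ≤
      ∑ i ∈ Finset.range n, ‖φ (Xs i ω)‖ := by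
    refine norm_sum_le_of_le _ fun i _ => ?_
    by_cases hi : Ss i ω ∈ B <;> simp [hi]
  calc _ ≤ 1 * ∑ i ∈ Finset.range n, ‖φ (Xs i ω)‖ := by
        gcongr
        exact (div_le_one hN0).2 hN1
    _ = _ := one_mul _

end PlugIn

section PlugInCube

variable {Ω 𝕏 H : Type*} [NormedAddCommGroup H] [InnerProductSpace ℝ H] {d ℓ : ℕ}

lemma plugInEstimator_eq_of_mem (φ : 𝕏 → H) (Xs : ℕ → Ω → 𝕏) (Ss : ℕ → Ω → UnitCube d)
    (S : Ω → UnitCube d) (n : ℕ) {ω : Ω} {j : Fin d → Fin ℓ} (hj : S ω ∈ dyadicCube d ℓ j) :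
    plugInEstimator φ Xs Ss S n ℓ ω = empiricalCondMean φ Xs Ss n (dyadicCube d ℓ j) ω := by
  rw [plugInEstimator, Finset.sum_eq_single j]
  · simp [hj]
  · intro i _ hij
    have : S ω ∉ dyadicCube d ℓ i := fun h => hij (eq_of_mem_dyadicCube h hj)
    simp [this]
  · simp

lemma norm_plugInEstimator_le (φ : 𝕏 → H) (Xs : ℕ → Ω → 𝕏) (Ss : ℕ → Ω → UnitCube d)
    (S : Ω → UnitCube d) (n : ℕ) (ω : Ω) :
    ‖plugInEstimator φ Xs Ss S n ℓ ω‖ ≤ ∑ i ∈ Finset.range n, ‖φ (Xs i ω)‖ := by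
  -- For `ℓ = 0` there may be no cube containing `S ω`; the estimator is then `0`.
  by_cases h : ∃ j : Fin d → Fin ℓ, S ω ∈ dyadicCube d ℓ j
  · obtain ⟨j, hj⟩ := h
    rw [plugInEstimator_eq_of_mem φ Xs Ss S n hj]
    exact norm_empiricalCondMean_le φ Xs Ss n _ ω
  · push Not at h
    have : plugInEstimator φ Xs Ss S n ℓ ω = 0 := by
      rw [plugInEstimator]
      exact Finset.sum_eq_zero fun j _ => by simp [h j]
    rw [this, norm_zero]
    exact Finset.sum_nonneg fun i _ => norm_nonneg _

lemma measurableSet_le_count {mΩ : MeasurableSpace Ω} {𝕊 : Type*} [MeasurableSpace 𝕊]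
    {Ss : ℕ → Ω → 𝕊} {n : ℕ} (hm : ∀ i ∈ Finset.range n, Measurable (Ss i)) {B : Set 𝕊}
    (hB : MeasurableSet B) (c : ℝ) :
    MeasurableSet {ω | c ≤ ∑ i ∈ Finset.range n, B.indicator (fun _ => (1 : ℝ)) (Ss i ω)} :=
  measurableSet_le measurable_const
    (Finset.measurable_fun_sum _ fun i hi => (measurable_const.indicator hB).comp (hm i hi))

variable [MeasurableSpace Ω]

/-- The event that every cube contains at least half the expected number of observations. -/
def manyInCubes (P : Measure Ω) (S : Ω → UnitCube d) (Ss : ℕ → Ω → UnitCube d) (n ℓ : ℕ) : Set Ω :=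
  ⋂ j : Fin d → Fin ℓ, {ω | n * P.real (S ⁻¹' dyadicCube d ℓ j) / 2 ≤
    ∑ i ∈ Finset.range n, (dyadicCube d ℓ j).indicator (fun _ => (1 : ℝ)) (Ss i ω)}

/-- The thresholds are deterministic and the counts depend on the sample only. -/
lemma measurableSet_manyInCubes [MeasurableSpace 𝕏] (P : Measure Ω) (S : Ω → UnitCube d)
    (Xs : ℕ → Ω → 𝕏) (Ss : ℕ → Ω → UnitCube d) (n ℓ : ℕ) :
    MeasurableSet[sampleSigma Xs Ss n] (manyInCubes P S Ss n ℓ) := by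
  have hm : ∀ i ∈ Finset.range n, Measurable[sampleSigma Xs Ss n] (Ss i) := by
    intro i hi
    have h1 : Measurable[sampleSigma Xs Ss n] fun ω => (Xs i ω, Ss i ω) :=
      (comap_measurable _).mono
        (le_iSup (fun i : Fin n => MeasurableSpace.comap (fun ω => (Xs i ω, Ss i ω)) inferInstance)
          ⟨i, Finset.mem_range.1 hi⟩) le_rfl
    exact measurable_snd.comp h1
  exact MeasurableSet.iInter fun j => measurableSet_le_count hm (measurableSet_dyadicCube j) _

variable [MeasurableSpace 𝕏] {P : Measure Ω} [IsProbabilityMeasure P]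
  {X : Ω → 𝕏} {S : Ω → UnitCube d} {Xs : ℕ → Ω → 𝕏} {Ss : ℕ → Ω → UnitCube d} {b : ℝ}

/-- Union bound: `ℓ ^ d` cubes, each failing with probability at most `4 ℓ ^ d / (n b)`. -/
lemma measure_compl_manyInCubes_le
    (hindep : iIndepFun
      (fun o : Option ℕ => o.elim (fun ω => (X ω, S ω)) (fun i ω => (Xs i ω, Ss i ω))) P)
    (hident : ∀ i, IdentDistrib (fun ω => (Xs i ω, Ss i ω)) (fun ω => (X ω, S ω)) P P)
    (hb : 0 < b) (hℓ : 1 ≤ ℓ)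
    (hp : ∀ j, b / (ℓ : ℝ) ^ d ≤ P.real (S ⁻¹' dyadicCube d ℓ j)) {n : ℕ} (hn : 1 ≤ n) :
    P (manyInCubes P S Ss n ℓ)ᶜ ≤ ENNReal.ofReal (4 * (ℓ : ℝ) ^ (2 * d) / (n * b)) := by
  have hℓ' : (0 : ℝ) < ℓ := by exact_mod_cast hℓ
  have hn' : (0 : ℝ) < n := by exact_mod_cast hn
  have hcell : ∀ j : Fin d → Fin ℓ, P {ω | ∑ i ∈ Finset.range n,
      (dyadicCube d ℓ j).indicator (fun _ => (1 : ℝ)) (Ss i ω) <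
        n * P.real (S ⁻¹' dyadicCube d ℓ j) / 2} ≤
      ENNReal.ofReal (4 * (ℓ : ℝ) ^ d / (n * b)) := by
    intro j
    have hpj : 0 < P.real (S ⁻¹' dyadicCube d ℓ j) := lt_of_lt_of_le (by positivity) (hp j)
    have := measure_count_lt_le hindep hident (A := Prod.snd ⁻¹' dyadicCube d ℓ j)
      (measurable_snd (measurableSet_dyadicCube j)) hpj hn
    refine this.trans (ENNReal.ofReal_le_ofReal ?_)
    have e : 4 * (ℓ : ℝ) ^ d / (n * b) = 4 / (n * (b / (ℓ : ℝ) ^ d)) := by field_simp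
    rw [e]
    gcongr
    exact hp j
  have hsub : (manyInCubes P S Ss n ℓ)ᶜ ⊆ ⋃ j : Fin d → Fin ℓ, {ω | ∑ i ∈ Finset.range n,
      (dyadicCube d ℓ j).indicator (fun _ => (1 : ℝ)) (Ss i ω) <
        n * P.real (S ⁻¹' dyadicCube d ℓ j) / 2} := by
    intro ω hω
    by_contra hcon
    refine hω (Set.mem_iInter.2 fun j => ?_)
    rw [Set.mem_ofPred_eq]
    by_contra! hlt
    exact hcon (Set.mem_iUnion.2 ⟨j, hlt⟩)
  refine (measure_mono hsub).trans ((measure_iUnion_le _).trans ?_)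
  rw [tsum_fintype]
  refine (Finset.sum_le_sum fun j _ => hcell j).trans (le_of_eq ?_)
  rw [Finset.sum_const, Finset.card_univ, Fintype.card_fun, Fintype.card_fin, Fintype.card_fin,
    nsmul_eq_mul, ← ENNReal.ofReal_natCast, ← ENNReal.ofReal_mul (by positivity)]
  congr 1
  push_cast
  ring

variable [CompleteSpace H] {φ : 𝕏 → H} {g : UnitCube d → H} {L : ℝ≥0}

lemma setLIntegral_enorm_plugIn_sub_sq_le (hS : Measurable S)
    (hindep : iIndepFun
      (fun o : Option ℕ => o.elim (fun ω => (X ω, S ω)) (fun i ω => (Xs i ω, Ss i ω))) P)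
    (hident : ∀ i, IdentDistrib (fun ω => (Xs i ω, Ss i ω)) (fun ω => (X ω, S ω)) P P)
    (hφ : StronglyMeasurable φ) (hL : MemLp (fun ω => φ (X ω)) 2 P)
    (hgL : LipschitzWith L g)
    (hg : P[fun ω => φ (X ω) | MeasurableSpace.comap S inferInstance] =ᵐ[P] g ∘ S)
    (hb : 0 < b) (hℓ : 1 ≤ ℓ)
    (hp : ∀ j, b / (ℓ : ℝ) ^ d ≤ P.real (S ⁻¹' dyadicCube d ℓ j)) {n : ℕ} (hn : 1 ≤ n) :
    ∫⁻ ω in manyInCubes P S Ss n ℓ, ‖plugInEstimator φ Xs Ss S n ℓ ω -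
        (P[fun ω => φ (X ω) | MeasurableSpace.comap S inferInstance]) ω‖ₑ ^ 2 ∂P ≤
      ENNReal.ofReal (8 * (ℓ : ℝ) ^ d * (∫ ω, ‖φ (X ω)‖ ^ 2 ∂P) / (n * b) +
        2 * (L * (√d / ℓ)) ^ 2) := by
  have hℓ' : (0 : ℝ) < ℓ := by exact_mod_cast hℓ
  have hn' : (0 : ℝ) < n := by exact_mod_cast hn
  set p : (Fin d → Fin ℓ) → ℝ := fun j => P.real (S ⁻¹' dyadicCube d ℓ j) with hpdef
  have hp0 : ∀ j, 0 < p j := fun j => lt_of_lt_of_le (by positivity) (hp j)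
  have hmB : ∀ j : Fin d → Fin ℓ, MeasurableSet (dyadicCube d ℓ j) := measurableSet_dyadicCube
  set m : (Fin d → Fin ℓ) → H := fun j => cellMean P (fun ω => φ (X ω)) S (dyadicCube d ℓ j)
    with hm
  set f : (Fin d → Fin ℓ) → 𝕏 × UnitCube d → H := fun j => cellDeviation φ (m j) (dyadicCube d ℓ j)
    with hf
  set χ : (Fin d → Fin ℓ) → UnitCube d → ℝ := fun j =>
    (dyadicCube d ℓ j).indicator fun _ => (1 : ℝ) with hχ
  have hχ0 : ∀ j s, 0 ≤ χ j s := fun j s => Set.indicator_nonneg (fun _ _ => zero_le_one) _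
  set D : ℝ := 2 * (L * (√d / ℓ)) ^ 2 with hD
  -- the variance of each cell
  have hcell := fun j => integral_indicator_mul_norm_sum_sample_sq hindep hident
    (stronglyMeasurable_cellDeviation hφ (m j) (hmB j)) (memLp_cellDeviation hL hS (hmB j) (m j))
    (integral_cellDeviation_cellMean hL hS (hmB j) (hp0 j)) n
    (A := Prod.snd ⁻¹' dyadicCube d ℓ j) (measurable_snd (hmB j))
  have hcint : ∀ j, Integrable (fun ω => χ j (S ω) *
      ‖∑ i ∈ Finset.range n, f j (Xs i ω, Ss i ω)‖ ^ 2) P := fun j => (hcell j).1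
  have hcval : ∀ j, ∫ ω, χ j (S ω) * ‖∑ i ∈ Finset.range n, f j (Xs i ω, Ss i ω)‖ ^ 2 ∂P ≤
      p j * (n * ∫ ω, χ j (S ω) * ‖φ (X ω)‖ ^ 2 ∂P) := by
    intro j
    refine (hcell j).2.le.trans ?_
    have := integral_norm_cellDeviation_cellMean_sq_le hL hS (hmB j) (hp0 j)
    exact mul_le_mul_of_nonneg_left (mul_le_mul_of_nonneg_left this hn'.le) (hp0 j).le
  have hφint : ∀ j, Integrable (fun ω => χ j (S ω) * ‖φ (X ω)‖ ^ 2) P := by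
    intro j
    refine (hL.integrable_norm_pow'.indicator (hS (hmB j))).congr (ae_of_all _ fun ω => ?_)
    by_cases h : S ω ∈ dyadicCube d ℓ j <;> simp [hχ, h]
  -- The `8` is `2 * 4`: the `2` comes from `(x + y)² ≤ 2 x² + 2 y²`, the `4` from squaring the half
  -- in `n p_j / 2`.
  set T : Ω → ℝ := fun ω => ∑ j, 8 / (n * p j) ^ 2 *
    (χ j (S ω) * ‖∑ i ∈ Finset.range n, f j (Xs i ω, Ss i ω)‖ ^ 2) + D with hT
  have hTint : Integrable T P :=
    (integrable_finsetSum _ fun j _ => (hcint j).const_mul _).add (integrable_const _)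
  have hT0 : ∀ ω, 0 ≤ T ω := fun ω => add_nonneg (Finset.sum_nonneg fun j _ =>
    mul_nonneg (by positivity) (mul_nonneg (hχ0 _ _) (by positivity))) (by positivity)
  -- pointwise bound
  have hpt : ∀ᵐ ω ∂P, ω ∈ manyInCubes P S Ss n ℓ → ‖plugInEstimator φ Xs Ss S n ℓ ω -
      (P[fun ω => φ (X ω) | MeasurableSpace.comap S inferInstance]) ω‖ₑ ^ 2 ≤
        ENNReal.ofReal (T ω) := by
    filter_upwards [hg] with ω hω hG
    rw [hω, ← ofReal_norm, ← ENNReal.ofReal_pow (norm_nonneg _)]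
    refine ENNReal.ofReal_le_ofReal ?_
    obtain ⟨j, hj⟩ := exists_mem_dyadicCube hℓ (S ω)
    rw [plugInEstimator_eq_of_mem φ Xs Ss S n hj]
    have h1 := norm_empiricalCondMean_sub_sq_le φ Xs Ss hn (dyadicCube d ℓ j) ω (m j)
      (c := n * p j / 2) (by have := hp0 j; positivity)
      (Set.mem_iInter.1 hG j)
    have h2 : ‖m j - g (S ω)‖ ≤ L * (√d / ℓ) :=
      norm_cellMean_sub_le (hL.integrable (by simp)) hS hgL hg (hmB j) (hp0 j)
        (fun s hs t ht => dist_le_of_mem_dyadicCube hs ht) hj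
    have h3 : ‖empiricalCondMean φ Xs Ss n (dyadicCube d ℓ j) ω - g (S ω)‖ ^ 2 ≤
        2 * ‖empiricalCondMean φ Xs Ss n (dyadicCube d ℓ j) ω - m j‖ ^ 2 +
          2 * ‖m j - g (S ω)‖ ^ 2 := by
      have := norm_sub_le_norm_sub_add_norm_sub
        (empiricalCondMean φ Xs Ss n (dyadicCube d ℓ j) ω) (m j) (g (S ω))
      calc _ ≤ (‖empiricalCondMean φ Xs Ss n (dyadicCube d ℓ j) ω - m j‖ +
            ‖m j - g (S ω)‖) ^ 2 := by gcongr
        _ ≤ _ := by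
          nlinarith [sq_nonneg (‖empiricalCondMean φ Xs Ss n (dyadicCube d ℓ j) ω - m j‖ -
            ‖m j - g (S ω)‖)]
    have h4 : ‖m j - g (S ω)‖ ^ 2 ≤ (L * (√d / ℓ)) ^ 2 := by gcongr
    have h5 : 8 / (n * p j) ^ 2 *
        (χ j (S ω) * ‖∑ i ∈ Finset.range n, f j (Xs i ω, Ss i ω)‖ ^ 2) ≤
        ∑ j, 8 / (n * p j) ^ 2 *
          (χ j (S ω) * ‖∑ i ∈ Finset.range n, f j (Xs i ω, Ss i ω)‖ ^ 2) :=
      Finset.single_le_sum (f := fun j => 8 / (n * p j) ^ 2 *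
          (χ j (S ω) * ‖∑ i ∈ Finset.range n, f j (Xs i ω, Ss i ω)‖ ^ 2))
        (fun j _ => mul_nonneg (by positivity) (mul_nonneg (hχ0 _ _) (by positivity)))
        (Finset.mem_univ j)
    have h6 : χ j (S ω) = 1 := Set.indicator_of_mem hj _
    have h7 : 2 * (‖∑ i ∈ Finset.range n, f j (Xs i ω, Ss i ω)‖ ^ 2 / (n * p j / 2) ^ 2) =
        8 / (n * p j) ^ 2 * (χ j (S ω) * ‖∑ i ∈ Finset.range n, f j (Xs i ω, Ss i ω)‖ ^ 2) := by
      have := hp0 j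
      rw [h6]
      field_simp
      ring
    simp only [hT, hD, Function.comp_apply]
    linarith
  calc _ ≤ ∫⁻ ω in manyInCubes P S Ss n ℓ, ENNReal.ofReal (T ω) ∂P := by
        have hGnull : NullMeasurableSet (manyInCubes P S Ss n ℓ) P := by
          refine NullMeasurableSet.iInter fun j => nullMeasurableSet_le aemeasurable_const ?_
          exact Finset.aemeasurable_fun_sum _ fun i _ =>
            (measurable_const.indicator (hmB j)).comp_aemeasurable
              (measurable_snd.comp_aemeasurable (hident i).aemeasurable_fst)
        exact lintegral_mono_ae ((ae_restrict_iff'₀ hGnull).2 hpt)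
    _ ≤ ∫⁻ ω, ENNReal.ofReal (T ω) ∂P := setLIntegral_le_lintegral _ _
    _ = ENNReal.ofReal (∫ ω, T ω ∂P) :=
        (ofReal_integral_eq_lintegral_ofReal hTint (ae_of_all _ hT0)).symm
    _ ≤ _ := by
        refine ENNReal.ofReal_le_ofReal ?_
        rw [hT, integral_add (integrable_finsetSum _ fun j _ => (hcint j).const_mul _)
          (integrable_const _), integral_finsetSum _ fun j _ => (hcint j).const_mul _]
        simp only [integral_const, probReal_univ, one_smul]
        gcongr
        -- The cubes partition the space, so the cell second moments add up to a single `E‖φ(X)‖²`;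
        -- the number of cubes costs no further factor.
        have hsum1 : ∑ j, ∫ ω, χ j (S ω) * ‖φ (X ω)‖ ^ 2 ∂P = ∫ ω, ‖φ (X ω)‖ ^ 2 ∂P := by
          rw [← integral_finsetSum _ fun j _ => hφint j]
          congr 1 with ω
          rw [← Finset.sum_mul]
          obtain ⟨j, hj⟩ := exists_mem_dyadicCube hℓ (S ω)
          rw [Finset.sum_eq_single j, hχ]
          · simp [hj]
          · intro i _ hij
            exact Set.indicator_of_notMem (fun h => hij (eq_of_mem_dyadicCube h hj)) _
          · simp
        calc _ ≤ ∑ j, 8 * (ℓ : ℝ) ^ d / (n * b) * ∫ ω, χ j (S ω) * ‖φ (X ω)‖ ^ 2 ∂P := by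
              refine Finset.sum_le_sum fun j _ => ?_
              rw [integral_const_mul]
              have hpj := hp0 j
              have hI0 : 0 ≤ ∫ ω, χ j (S ω) * ‖φ (X ω)‖ ^ 2 ∂P :=
                integral_nonneg fun ω => mul_nonneg (hχ0 _ _) (by positivity)
              calc _ ≤ 8 / (n * p j) ^ 2 * (p j * (n * ∫ ω, χ j (S ω) * ‖φ (X ω)‖ ^ 2 ∂P)) := by
                    gcongr
                    exact hcval j
                _ = 8 / (n * p j) * ∫ ω, χ j (S ω) * ‖φ (X ω)‖ ^ 2 ∂P := by
                    field_simp
                _ ≤ 8 / (n * (b / (ℓ : ℝ) ^ d)) * ∫ ω, χ j (S ω) * ‖φ (X ω)‖ ^ 2 ∂P := by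
                    gcongr
                    exact hp j
                _ = _ := by field_simp
          _ = _ := by
              rw [← Finset.mul_sum, hsum1]
              ring

/-- The plug-in estimator has a finite mean square error. -/
lemma lintegral_enorm_plugIn_sub_sq_ne_top (hS : Measurable S)
    (hident : ∀ i, IdentDistrib (fun ω => (Xs i ω, Ss i ω)) (fun ω => (X ω, S ω)) P P)
    (hφ : StronglyMeasurable φ) (hL : MemLp (fun ω => φ (X ω)) 2 P)
    (hgL : LipschitzWith L g)
    (hg : P[fun ω => φ (X ω) | MeasurableSpace.comap S inferInstance] =ᵐ[P] g ∘ S) (n ℓ : ℕ) :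
    ∫⁻ ω, ‖plugInEstimator φ Xs Ss S n ℓ ω -
        (P[fun ω => φ (X ω) | MeasurableSpace.comap S inferInstance]) ω‖ₑ ^ 2 ∂P ≠ ∞ := by
  -- The bias bound for the single cube of side `1` shows that `g` is bounded.
  obtain ⟨C, hC⟩ : ∃ C : ℝ, ∀ s, ‖g s‖ ≤ C := by
    have hpre : S ⁻¹' dyadicCube d 1 (fun _ => 0) = Set.univ := by simp [dyadicCube_one]
    refine ⟨‖cellMean P (fun ω => φ (X ω)) S (dyadicCube d 1 fun _ => 0)‖ + L * (√d / (1 : ℕ)),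
      fun s => ?_⟩
    have := norm_cellMean_sub_le (hL.integrable (by simp)) hS hgL hg
      (measurableSet_dyadicCube (fun _ => (0 : Fin 1))) (by rw [hpre]; simp)
      (fun s hs t ht => dist_le_of_mem_dyadicCube hs ht) (s := s) (by simp [dyadicCube_one])
    exact (norm_le_norm_add_norm_sub _ _).trans (by gcongr)
  have hφi : ∀ i, MemLp (fun ω => ‖φ (Xs i ω)‖) 2 P := fun i =>
    (memLp_comp_sample hident (f := fun p => φ p.1) (hφ.comp_measurable measurable_fst) hL i).norm
  have hB : MemLp (fun ω => ∑ i ∈ Finset.range n, ‖φ (Xs i ω)‖ + C) 2 P :=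
    (memLp_finsetSum _ fun i _ => hφi i).add (memLp_const C)
  have hfin := (eLpNorm_lt_top_iff_lintegral_rpow_enorm_lt_top (by simp) (by simp)).1 hB.2
  refine ne_top_of_le_ne_top hfin.ne (lintegral_mono_ae ?_)
  filter_upwards [hg] with ω hω
  rw [hω]
  simp only [ENNReal.toReal_ofNat, ENNReal.rpow_ofNat]
  gcongr
  rw [enorm_le_iff_norm_le]
  refine (norm_sub_le _ _).trans (le_trans ?_ (le_abs_self _))
  exact add_le_add (norm_plugInEstimator_le φ Xs Ss S n ω) (hC _)

end PlugInCube

/-! ### From mean square bounds to the stochastic order -/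

lemma sampleSigma_le {Ω 𝕏 𝕊 : Type*} [mΩ : MeasurableSpace Ω] [MeasurableSpace 𝕏]
    [MeasurableSpace 𝕊] {Xs : ℕ → Ω → 𝕏} {Ss : ℕ → Ω → 𝕊} (hXs : ∀ i, Measurable (Xs i))
    (hSs : ∀ i, Measurable (Ss i)) (n : ℕ) : sampleSigma Xs Ss n ≤ mΩ :=
  iSup_le fun i => ((hXs i).prodMk (hSs i)).comap_le

/-- A sequence is bounded in outer probability as soon as it is so eventually and each of its
members is tight. -/
lemma isBigOStarP_of_eventually {Ω : Type*} [MeasurableSpace Ω] {P : Measure Ω}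
    {Y : ℕ → Ω → ℝ≥0∞} {r : ℕ → ℝ} (hr : ∀ n, 0 ≤ r n)
    (hev : ∀ ε : ℝ, 0 < ε → ∃ M : ℝ, 0 < M ∧ ∀ᶠ n in atTop,
      P {ω | ENNReal.ofReal (M * r n) < Y n ω} ≤ ENNReal.ofReal ε)
    (hone : ∀ n, 1 ≤ n → ∀ ε : ℝ, 0 < ε → ∃ M : ℝ, 0 < M ∧
      P {ω | ENNReal.ofReal (M * r n) < Y n ω} ≤ ENNReal.ofReal ε) :
    IsBigOStarP P Y r := by
  intro ε hε
  obtain ⟨M₀, hM₀, hev⟩ := hev ε hε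
  obtain ⟨n₀, hn₀⟩ := eventually_atTop.1 hev
  have hone' : ∀ n, ∃ M : ℝ, 0 < M ∧
      (1 ≤ n → P {ω | ENNReal.ofReal (M * r n) < Y n ω} ≤ ENNReal.ofReal ε) := by
    intro n
    by_cases hn : 1 ≤ n
    · obtain ⟨M, hM, h⟩ := hone n hn ε hε
      exact ⟨M, hM, fun _ => h⟩
    · exact ⟨1, one_pos, fun h => absurd h hn⟩
  choose M hM hMn using hone'
  have hs0 : 0 ≤ ∑ i ∈ Finset.range n₀, M i := Finset.sum_nonneg fun i _ => (hM i).le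
  have hmono : ∀ n {a c : ℝ}, a ≤ c → P {ω | ENNReal.ofReal (c * r n) < Y n ω} ≤
      P {ω | ENNReal.ofReal (a * r n) < Y n ω} := fun n a c hac =>
    measure_mono fun ω hω => lt_of_le_of_lt (ENNReal.ofReal_le_ofReal
      (mul_le_mul_of_nonneg_right hac (hr n))) hω
  refine ⟨M₀ + ∑ i ∈ Finset.range n₀, M i, by positivity, fun n hn => ?_⟩
  rcases le_or_gt n₀ n with h | h
  · exact (hmono n (by linarith)).trans (hn₀ n h)
  · refine (hmono n ?_).trans (hMn n hn)
    have := Finset.single_le_sum (f := M) (fun i _ => (hM i).le) (Finset.mem_range.2 h)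
    linarith

/-- With `q = n ^ (1 / (2 (d + 1)))` and `ℓ ≍ q`, the squared error bound is of order `q ^ (-2)` and
the probability of a sparse cube is at most of order `q ^ (-2)`. -/
lemma rate_bounds {d : ℕ} {q ℓ c C b K L' : ℝ} (hq : 1 ≤ q) (hc : 0 < c) (hb : 0 < b)
    (hK : 0 ≤ K) (hL' : 0 ≤ L') (h1 : c * q ≤ ℓ) (h2 : ℓ ≤ C * q) :
    8 * ℓ ^ d * K / (q ^ (2 * (d + 1)) * b) + 2 * (L' * (√d / ℓ)) ^ 2 ≤
        (8 * C ^ d * K / b + 2 * (L' * (√d / c)) ^ 2) * (q⁻¹) ^ 2 ∧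
      4 * ℓ ^ (2 * d) / (q ^ (2 * (d + 1)) * b) ≤ 4 * C ^ (2 * d) / b * (q⁻¹) ^ 2 := by
  have hq0 : 0 < q := one_pos.trans_le hq
  have hℓ0 : 0 < ℓ := (by positivity : 0 < c * q).trans_le h1
  have hC0 : 0 < C := by
    by_contra! h
    nlinarith
  -- The variance term is in fact of order `q ^ (-d - 2)`; the slack is given away here.
  have hqd : q ^ d ≤ q ^ (2 * d) := pow_le_pow_right₀ hq (by omega)
  refine ⟨?_, ?_⟩
  · rw [add_mul]
    gcongr ?_ + ?_
    · calc 8 * ℓ ^ d * K / (q ^ (2 * (d + 1)) * b)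
          ≤ 8 * (C ^ d * q ^ (2 * d)) * K / (q ^ (2 * (d + 1)) * b) := by
            gcongr
            calc ℓ ^ d ≤ (C * q) ^ d := by gcongr
              _ = C ^ d * q ^ d := mul_pow _ _ _
              _ ≤ _ := by gcongr
        _ = 8 * C ^ d * K / b * (q⁻¹) ^ 2 := by
            rw [show 2 * (d + 1) = 2 * d + 2 by ring, pow_add]
            field_simp
    · calc 2 * (L' * (√d / ℓ)) ^ 2 ≤ 2 * (L' * (√d / (c * q))) ^ 2 := by gcongr
        _ = _ := by field_simp
  · calc 4 * ℓ ^ (2 * d) / (q ^ (2 * (d + 1)) * b)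
        ≤ 4 * (C * q) ^ (2 * d) / (q ^ (2 * (d + 1)) * b) := by gcongr
      _ = _ := by
          rw [show 2 * (d + 1) = 2 * d + 2 by ring, pow_add, mul_pow]
          field_simp

end ObliviousFeatures

theorem proposition5 {Ω 𝕏 H : Type*} [MeasurableSpace Ω] [MeasurableSpace 𝕏]
    [NormedAddCommGroup H] [InnerProductSpace ℝ H] [CompleteSpace H] [RKHS ℝ H 𝕏 ℝ]
    (P : Measure Ω) [IsProbabilityMeasure P] (d : ℕ) (hd : 1 ≤ d)
    -- the pair `(X, S)`, and the observations `(X_i, S_i)`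
    (X : Ω → 𝕏) (S : Ω → ObliviousFeatures.UnitCube d)
    (Xs : ℕ → Ω → 𝕏) (Ss : ℕ → Ω → ObliviousFeatures.UnitCube d)
    (hX : Measurable X) (hS : Measurable S)
    (hXs : ∀ i, Measurable (Xs i)) (hSs : ∀ i, Measurable (Ss i))
    (hindep : iIndepFun
      (fun o : Option ℕ => o.elim (fun ω => (X ω, S ω)) (fun i ω => (Xs i ω, Ss i ω))) P)
    (hident : ∀ i, IdentDistrib (fun ω => (Xs i ω, Ss i ω)) (fun ω => (X ω, S ω)) P P)
    -- `φ(X)` is a Bochner-integrable random variable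
    (hφ : StronglyMeasurable (ObliviousFeatures.featureMap H : 𝕏 → H))
    (hφX : Integrable (fun ω => ObliviousFeatures.featureMap H (X ω)) P)
    -- the law of `S` has a Lebesgue density bounded below by `b`
    (u : ObliviousFeatures.UnitCube d → ℝ≥0∞) (hu : Measurable u)
    (hdensity : P.map S = (ObliviousFeatures.cubeVolume d).withDensity u)
    (b : ℝ) (hb : 0 < b) (hub : ∀ s, ENNReal.ofReal b ≤ u s)
    -- `E^S φ(X) = g ∘ S` with `g` Lipschitz
    (g : ObliviousFeatures.UnitCube d → H) (L : ℝ≥0) (hgL : LipschitzWith L g)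
    (hg : P[fun ω => ObliviousFeatures.featureMap H (X ω) | MeasurableSpace.comap S inferInstance]
      =ᵐ[P] g ∘ S)
    (hDonsker : ObliviousFeatures.IsDonsker (P.map fun ω => (X ω, S ω))
      (ObliviousFeatures.dyadicBallClass H d))
    -- the side lengths `1 / ℓ n` of the cubes are of order `n ^ (-1 / (2 (d + 1)))`
    (ℓ : ℕ → ℕ)
    (hℓ : (fun n => (ℓ n : ℝ)) =Θ[atTop] fun n => (n : ℝ) ^ (1 / (2 * ((d : ℝ) + 1)))) :
    ObliviousFeatures.IsBigOStarP P
      (fun n => ObliviousFeatures.condL2Norm P (ObliviousFeatures.sampleSigma Xs Ss n)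
        (fun ω =>
          ObliviousFeatures.plugInEstimator
            (ObliviousFeatures.featureMap H) Xs Ss S n (ℓ n) ω
          - (P[fun ω' => ObliviousFeatures.featureMap H (X ω') |
              MeasurableSpace.comap S inferInstance]) ω))
      (fun n => (n : ℝ) ^ (-(1 / (2 * ((d : ℝ) + 1))))) := by
  set φ : 𝕏 → H := ObliviousFeatures.featureMap H with hφdef
  have hW : Measurable fun ω => (X ω, S ω) := hX.prodMk hS
  have hL : MemLp (fun ω => φ (X ω)) 2 P := by
    have : IsProbabilityMeasure (P.map fun ω => (X ω, S ω)) :=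
      Measure.isProbabilityMeasure_map hW.aemeasurable
    have hfm : StronglyMeasurable fun p : 𝕏 × ObliviousFeatures.UnitCube d => φ p.1 :=
      hφ.comp_measurable measurable_fst
    have h := hDonsker.memLp_featureMap hφ
      ((integrable_map_measure hfm.aestronglyMeasurable hW.aemeasurable).2 hφX)
    exact (memLp_map_measure_iff hfm.aestronglyMeasurable hW.aemeasurable).1 h
  set Z : ℕ → Ω → H := fun n ω => ObliviousFeatures.plugInEstimator φ Xs Ss S n (ℓ n) ω -
    (P[fun ω' => φ (X ω') | MeasurableSpace.comap S inferInstance]) ω with hZ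
  set α : ℝ := 1 / (2 * ((d : ℝ) + 1)) with hα
  have hα0 : 0 < α := by positivity
  have hle := fun n => ObliviousFeatures.sampleSigma_le hXs hSs n
  have hq0 : ∀ n : ℕ, 1 ≤ n → 0 < (n : ℝ) ^ (-α) := fun n hn =>
    Real.rpow_pos_of_pos (by exact_mod_cast hn) _
  refine ObliviousFeatures.isBigOStarP_of_eventually (fun n => by positivity) (fun ε hε => ?_) (fun n hn ε hε => ?_)
  · obtain ⟨C, hC⟩ := hℓ.1.bound
    obtain ⟨c, hc, hcb⟩ := hℓ.2.exists_pos
    have hcb := hcb.bound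
    set K := ∫ ω, ‖φ (X ω)‖ ^ 2 ∂P with hK
    have hK0 : 0 ≤ K := integral_nonneg fun ω => by positivity
    set A := 8 * C ^ d * K / b + 2 * (L * (√d / c⁻¹)) ^ 2 with hA
    -- The sign of `C`, and hence of `A`, is not known at this point, so `|A|` is used.
    have hM : ∃ M : ℝ, 0 < M ∧ |A| / M ^ 2 ≤ ε / 2 := by
      refine ⟨√(|A| / (ε / 2)) + 1, by positivity, ?_⟩
      rw [div_le_iff₀ (by positivity), ← div_le_iff₀' (by positivity)]
      calc |A| / (ε / 2) = √(|A| / (ε / 2)) ^ 2 := (Real.sq_sqrt (by positivity)).symm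
        _ ≤ _ := by gcongr; linarith
    obtain ⟨M, hM0, hMA⟩ := hM
    refine ⟨M, hM0, ?_⟩
    have hqt : Tendsto (fun n : ℕ => (n : ℝ) ^ α) atTop atTop :=
      (tendsto_rpow_atTop hα0).comp tendsto_natCast_atTop_atTop
    have hsmall : ∀ᶠ n : ℕ in atTop, 4 * C ^ (2 * d) / b * (((n : ℝ) ^ α)⁻¹) ^ 2 ≤ ε / 2 := by
      have h := ((tendsto_inv_atTop_zero.comp hqt).pow 2).const_mul (4 * C ^ (2 * d) / b)
      rw [zero_pow two_ne_zero, mul_zero] at h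
      exact h.eventually_le_const (by positivity)
    filter_upwards [hC, hcb, hsmall, eventually_ge_atTop 1] with n hCn hcn hsn hn
    have hn' : (1 : ℝ) ≤ n := by exact_mod_cast hn
    have hq1 : 1 ≤ (n : ℝ) ^ α := Real.one_le_rpow hn' hα0.le
    set q := (n : ℝ) ^ α with hq
    have hqpos : 0 < q := one_pos.trans_le hq1
    have hqn : q ^ (2 * (d + 1)) = n := by
      rw [hq, ← Real.rpow_natCast, ← Real.rpow_mul (by positivity), hα]
      push_cast
      rw [one_div_mul_cancel (by positivity), Real.rpow_one]
    have hr : (n : ℝ) ^ (-α) = q⁻¹ := Real.rpow_neg (by positivity) _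
    rw [Real.norm_natCast, Real.norm_of_nonneg hqpos.le] at hCn hcn
    have hcn' : c⁻¹ * q ≤ ℓ n := by rwa [inv_mul_le_iff₀ hc]
    have hℓ1 : 1 ≤ ℓ n := by
      have : (0 : ℝ) < ℓ n := lt_of_lt_of_le (by positivity) hcn'
      exact_mod_cast this
    have hp := fun j => ObliviousFeatures.le_measureReal_preimage_dyadicCube (ℓ := ℓ n) hS hdensity hb.le hub j
    obtain ⟨hb1, hb2⟩ := ObliviousFeatures.rate_bounds (d := d) hq1 (inv_pos.2 hc) hb hK0 L.coe_nonneg hcn' hCn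
    have hmain := ObliviousFeatures.measure_lt_condL2Norm_le (P := P) (hle n) (Z n)
      (ObliviousFeatures.measurableSet_manyInCubes P S Xs Ss n (ℓ n)) (t := M * q⁻¹) (by positivity)
    have hbad := ObliviousFeatures.measure_compl_manyInCubes_le hindep hident hb hℓ1 hp hn
    have hgood := ObliviousFeatures.setLIntegral_enorm_plugIn_sub_sq_le hS hindep hident hφ hL hgL hg hb hℓ1 hp hn
    rw [← hqn] at hbad hgood
    rw [hr]
    refine hmain.trans ?_
    have e1 : P (ObliviousFeatures.manyInCubes P S Ss n (ℓ n))ᶜ ≤ ENNReal.ofReal (ε / 2) :=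
      hbad.trans (ENNReal.ofReal_le_ofReal (hb2.trans hsn))
    have e2 : (∫⁻ ω in ObliviousFeatures.manyInCubes P S Ss n (ℓ n), ‖Z n ω‖ₑ ^ 2 ∂P) /
        ENNReal.ofReal ((M * q⁻¹) ^ 2) ≤ ENNReal.ofReal (ε / 2) := by
      refine (ENNReal.div_le_div_right (hgood.trans (ENNReal.ofReal_le_ofReal hb1)) _).trans ?_
      rw [← ENNReal.ofReal_div_of_pos (by positivity)]
      refine ENNReal.ofReal_le_ofReal (le_trans ?_ hMA)
      have : A * q⁻¹ ^ 2 / (M * q⁻¹) ^ 2 = A / M ^ 2 := by field_simp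
      rw [← hA, this]
      gcongr
      exact le_abs_self A
    calc _ ≤ ENNReal.ofReal (ε / 2) + ENNReal.ofReal (ε / 2) := add_le_add e1 e2
      _ = ENNReal.ofReal ε := by
        rw [← ENNReal.ofReal_add (by positivity) (by positivity), add_halves]
  -- For a fixed `n`, where even `ℓ n = 0` is possible, Markov's inequality on the whole space
  -- suffices.
  · have hfin := ObliviousFeatures.lintegral_enorm_plugIn_sub_sq_ne_top hS hident hφ hL hgL hg n (ℓ n)
    set I := ∫⁻ ω, ‖Z n ω‖ₑ ^ 2 ∂P with hI
    have hr := hq0 n hn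
    set r := (n : ℝ) ^ (-α) with hrdef
    refine ⟨(√(I.toReal / ε) + 1) / r, by positivity, ?_⟩
    rw [div_mul_cancel₀ _ hr.ne']
    have hmain := ObliviousFeatures.measure_lt_condL2Norm_le (P := P) (hle n) (Z n)
      (MeasurableSet.univ) (t := √(I.toReal / ε) + 1) (by positivity)
    refine hmain.trans ?_
    rw [Set.compl_univ, measure_empty, zero_add, Measure.restrict_univ, ← hI,
      ← ENNReal.ofReal_toReal hfin, ← ENNReal.ofReal_div_of_pos (by positivity)]
    refine ENNReal.ofReal_le_ofReal ?_
    rw [ENNReal.toReal_ofReal ENNReal.toReal_nonneg, div_le_iff₀ (by positivity),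
      ← div_le_iff₀' hε]
    calc I.toReal / ε = √(I.toReal / ε) ^ 2 := (Real.sq_sqrt (by positivity)).symm
      _ ≤ _ := by gcongr; linarith
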